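/- **Setting.** There are $N$ devices. Device $k$ owns $n_k\ge 1$ data points and has a local objective $F_k:\mathbb{R}^d\to\mathbb{R}$. Put $p^k=n_k/\sum_j n_j$ and $F=\sum_k p^kF_k$, let $w^*$ be the minimizer of $F$, let $F_k^*=\min F_k$, and put $\Gamma_k=F_k(w^*)-F_k^*$. Training runs for $T\ge 1$ rounds of $E$ time steps each. From a random initial weight $w_0^{\mathcal G}$ with finite second moment, round $\tau\in\{0,\dots,T-1\}$ proceeds as follows. Every device starts at $w_{\tau E}^k=w_{\tau E}^{\mathcal G}$ and makes $s_\tau^k$ local updates $$w_{\tau E+i+1}^k=w_{\tau E+i}^k-\eta_\tau g_{\tau E+i}^k,\quad 0\le i<s_\tau^k,\qquad g_t^k=\nabla F_k(w_t^k,\xi_t^k),$$ and then $$w_{(\tau+1)E}^{\mathcal G}=w_{\tau E}^{\mathcal G}+\sum_{k=1}^N p_\tau^k\bigl(w_{\tau E+s_\tau^k}^k-w_{\tau E}^{\mathcal G}\bigr).$$ Here $s_\tau^k\in\{0,\dots,E\}$ and $p_\tau^k\ge 0$ are random (and may depend on each other within a round), and $\xi_t^k$ is a random mini-batch. The initial weight,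 the participation patterns $(p_\tau^k,s_\tau^k)_{k}$ of the rounds $\tau$, and the mini-batches $\xi_t^k$ are all mutually independent. Stochastic gradients are unbiased: $\mathbb{E}_\xi[\nabla F_k(w,\xi_t^k)]=\nabla F_k(w)$ for all $w$. **Assumptions.** There are constants $L,\mu,\theta>0$, $G$ and $\sigma_1,\dots,\sigma_N$ such that 1. every $F_k$ is $L$-smooth (differentiable with $L$-Lipschitz gradient); 2. every $F_k$ is $\mu$-strongly convex; 3. $\mathbb{E}\|g_t^k-\nabla F_k(w_t^k)\|^2\le\sigma_k^2$ for all $k$, $t$, and 4. $\mathbb{E}\|g_t^k\|^2\le G^2$ for all $k$, $t$, where for $t=\tau E+i$ the expectations in 3 and 4 are conditioned on the event $i<s_\tau^k$ that the gradient is computed (nothing is required if this event has probability $0$); 5. $p_\tau^k/p^k\le\theta$ almost surely for all $k$, $\tau$; 6. the expectations $\mathbb{E}[p_\tau^k]$, $\mathbb{E}[p_\tau^ks_\tau^k]$, $\mathbb{E}[(p_\tau^k)^2s_\tau^k]$ and $\mathbb{E}[(\sum_kp_\tau^k-2)_+\sum_kp_\tau^ks_\tau^k]$ do not depend on $\tau$,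 and $S:=\mathbb{E}[\sum_kp_\tau^ks_\tau^k]\ne 0$. **Constants.** Let $$\gamma=\max\Bigl\{\frac{32E(1+\theta)L}{\mu S},\frac{4E^2\theta}{S}\Bigr\},\qquad D=\frac{64E\sum_{k}\mathbb{E}[p_\tau^ks_\tau^k]\Gamma_k}{\mu S},$$ $$V=\max\Bigl\{\gamma^2\,\mathbb{E}\|w_0^{\mathcal G}-w^*\|^2,\ \Bigl(\frac{16E}{\mu S}\Bigr)^2\frac{\mathbb{E}[B_\tau]}{E}\Bigr\},$$ $$\begin{aligned}B_\tau={}&2(2+\theta)L\sum_kp_\tau^ks_\tau^k\Gamma_k+\Bigl(2+\frac{\mu}{2(1+\theta)L}\Bigr)E(E-1)G^2\Bigl(\sum_kp_\tau^ks_\tau^k+\theta\bigl(\sum_kp_\tau^k-2\bigr)_+\sum_kp_\tau^ks_\tau^k\Bigr)\\&+2EG^2\sum_k\frac{(p_\tau^k)^2}{p^k}s_\tau^k+\sum_k(p_\tau^k)^2s_\tau^k\sigma_k^2.\end{aligned}$$ Let $z_\tau=0$ if $\mathbb{E}[p_\tau^ks_\tau^k]/p^k$ takes the same value for all $k$, let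 $z_\tau=1$ otherwise, and put $M_\tau=\sum_{t=0}^{\tau-1}z_t$. **Theorem.** With the step size $\eta_\tau=\dfrac{16E}{\mu S}\cdot\dfrac{1}{\tau E+\gamma}$, for every $\tau\in\{0,\dots,T\}$ the random variable $\|w_{\tau E}^{\mathcal G}-w^*\|^2$ is integrable and $$\mathbb{E}\|w_{\tau E}^{\mathcal G}-w^*\|^2\le\frac{M_\tau D+V}{\tau E+\gamma}.$$ -/

import Mathlib

open MeasureTheory ProbabilityTheory

/-- The space of model parameters, with its Euclidean norm. -/
abbrev Param (d : ℕ) : Type := EuclideanSpace ℝ (Fin d)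

/-- `f` is `L`-smooth: differentiable with `L`-Lipschitz gradient. -/
def IsLSmooth {d : ℕ} (L : ℝ) (f : Param d → ℝ) : Prop :=
  Differentiable ℝ f ∧ ∀ x y, ‖gradient f x - gradient f y‖ ≤ L * ‖x - y‖

/-- The data of a run of FedAvg with `N` devices and flexible device participation, on a sample
space `Ω`. Time step `t = τ E + i` with `i < E` is written as the pair `(τ, i)`. -/
structure FedAvg (d N : ℕ) (Ω : Type*) (Ξ : Fin N → Type*) where
  /-- number of time steps in a round -/
  E : ℕ
  /-- number of data points of each device -/
  n : Fin N → ℕ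
  /-- local objective functions -/
  F : Fin N → Param d → ℝ
  /-- stochastic gradient of device `k` at a parameter, on a mini-batch -/
  g : (k : Fin N) → Param d → Ξ k → Param d
  /-- initial global weight -/
  w₀ : Ω → Param d
  /-- `ξ τ i k` is the mini-batch of device `k` at time step `τ E + i` -/
  ξ : ℕ → ℕ → (k : Fin N) → Ω → Ξ k
  /-- `s τ k` is the number of local updates of device `k` in round `τ` -/
  s : ℕ → Fin N → Ω → ℕ
  /-- `p τ k` is the aggregation coefficient of device `k` in round `τ` -/
  p : ℕ → Fin N → Ω → ℝ

/-- The independent sources of randomness of a run of `T` rounds: the initial weight, the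
participation pattern of each round, and each single mini-batch. -/
inductive RandomSource (N T E : ℕ) : Type
  | init : RandomSource N T E
  | participation (τ : Fin T) : RandomSource N T E
  | batch (τ : Fin T) (i : Fin E) (k : Fin N) : RandomSource N T E

namespace FedAvg

noncomputable section

variable {d N : ℕ} {Ω : Type*} {Ξ : Fin N → Type*}

/-- The weight `n_k / n` of device `k` in the global objective. -/
def weight (A : FedAvg d N Ω Ξ) (k : Fin N) : ℝ := (A.n k : ℝ) / ∑ j, (A.n j : ℝ)

/-- The global objective. -/
def objective (A : FedAvg d N Ω Ξ) (w : Param d) : ℝ := ∑ k, A.weight k * A.F k w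

/-- `Γ_k = F_k(w*) - F_k*`, where `F_k*` is the minimum value of `F_k`. -/
def noniid (A : FedAvg d N Ω Ξ) (wStar : Param d) (k : Fin N) : ℝ :=
  A.F k wStar - ⨅ w, A.F k w

/-- Local SGD of device `k` in round `τ`, started at `w`: the weight after `i` local updates. -/
def localSGD (A : FedAvg d N Ω Ξ) (η : ℕ → ℝ) (τ : ℕ) (k : Fin N) (w : Param d) (ω : Ω) :
    ℕ → Param d
  | 0 => w
  | i + 1 => localSGD A η τ k w ω i - η τ • A.g k (localSGD A η τ k w ω i) (A.ξ τ i k ω)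

/-- The global weight at time step `τ E`: in each round, device `k` starts from the global weight
and makes `s τ k` local updates; the resulting increments are aggregated with
coefficients `p τ k`. -/
def globalWeight (A : FedAvg d N Ω Ξ) (η : ℕ → ℝ) : ℕ → Ω → Param d
  | 0 => A.w₀
  | τ + 1 => fun ω => globalWeight A η τ ω +
      ∑ k, A.p τ k ω •
        (A.localSGD η τ k (globalWeight A η τ ω) ω (A.s τ k ω) - globalWeight A η τ ω)

/-- The local weight of device `k` at time step `τ E + i`. It is a weight of the algorithm
when `i ≤ s τ k`. -/
def localWeight (A : FedAvg d N Ω Ξ) (η : ℕ → ℝ) (τ i : ℕ) (k : Fin N) (ω : Ω) : Param d :=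
  A.localSGD η τ k (A.globalWeight η τ ω) ω i

/-- The stochastic gradient of device `k` at time step `τ E + i`. -/
def stochGrad (A : FedAvg d N Ω Ξ) (η : ℕ → ℝ) (τ i : ℕ) (k : Fin N) (ω : Ω) : Param d :=
  A.g k (A.localWeight η τ i k ω) (A.ξ τ i k ω)

/-- The full-batch gradient of device `k` at time step `τ E + i`. -/
def fullGrad (A : FedAvg d N Ω Ξ) (η : ℕ → ℝ) (τ i : ℕ) (k : Fin N) (ω : Ω) : Param d :=
  gradient (A.F k) (A.localWeight η τ i k ω)

/-- The event that device `k` carries out the local update of time step `τ E + i`. -/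
def executed (A : FedAvg d N Ω Ξ) (τ i : ℕ) (k : Fin N) : Set Ω := {ω | i < A.s τ k ω}

/-- The σ-algebra generated by one source of randomness. -/
@[reducible] def sourceSigma [∀ k, MeasurableSpace (Ξ k)] (A : FedAvg d N Ω Ξ) (T : ℕ) :
    RandomSource N T A.E → MeasurableSpace Ω
  | .init => MeasurableSpace.comap A.w₀ inferInstance
  | .participation τ =>
      MeasurableSpace.comap (fun ω (k : Fin N) => (A.p τ k ω, A.s τ k ω)) inferInstance
  | .batch τ i k => MeasurableSpace.comap (A.ξ τ i k) inferInstance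

variable [MeasurableSpace Ω] [∀ k, MeasurableSpace (Ξ k)]

/-- The probabilistic model of a run of `T` rounds: all objects are measurable, the initial weight
has a finite second moment, every device owns data, devices make at most `E` updates per round,
aggregation coefficients are nonnegative, stochastic gradients are unbiased, and the initial weight,
the participation patterns `(p τ, s τ)` of the rounds and the mini-batches are independent. Within a
round, the `p τ k` and `s τ k` may depend on each other in any way. -/
structure IsModel (A : FedAvg d N Ω Ξ) (P : Measure Ω) (T : ℕ) : Prop where
  measurable_g : ∀ k, Measurable (fun x : Param d × Ξ k => A.g k x.1 x.2)
  measurable_w₀ : Measurable A.w₀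
  measurable_ξ : ∀ τ < T, ∀ i < A.E, ∀ k, Measurable (A.ξ τ i k)
  measurable_s : ∀ τ < T, ∀ k, Measurable (A.s τ k)
  measurable_p : ∀ τ < T, ∀ k, Measurable (A.p τ k)
  memLp_w₀ : MemLp A.w₀ 2 P
  n_pos : ∀ k, 0 < A.n k
  s_le : ∀ τ < T, ∀ k ω, A.s τ k ω ≤ A.E
  p_nonneg : ∀ τ < T, ∀ k, ∀ᵐ ω ∂P, 0 ≤ A.p τ k ω
  unbiased : ∀ τ < T, ∀ i < A.E, ∀ k, ∀ w : Param d,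
    Integrable (fun ω => A.g k w (A.ξ τ i k ω)) P ∧
      ∫ ω, A.g k w (A.ξ τ i k ω) ∂P = gradient (A.F k) w
  indep : iIndep (A.sourceSigma T) P

/-- The variance of the executed stochastic gradients is bounded by `σ_k²`. The expectation is
conditioned on the event that the gradient is computed at all. -/
def BoundedVariance (A : FedAvg d N Ω Ξ) (P : Measure Ω) (T : ℕ) (η : ℕ → ℝ) (σ : Fin N → ℝ) :
    Prop :=
  ∀ τ < T, ∀ i < A.E, ∀ k,
    ∫⁻ ω, ‖A.stochGrad η τ i k ω - A.fullGrad η τ i k ω‖ₑ ^ 2 ∂(cond P (A.executed τ i k))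
      ≤ ENNReal.ofReal (σ k ^ 2)

/-- The second moment of the executed stochastic gradients is bounded by `G²`. -/
def BoundedSecondMoment (A : FedAvg d N Ω Ξ) (P : Measure Ω) (T : ℕ) (η : ℕ → ℝ) (G : ℝ) : Prop :=
  ∀ τ < T, ∀ i < A.E, ∀ k,
    ∫⁻ ω, ‖A.stochGrad η τ i k ω‖ₑ ^ 2 ∂(cond P (A.executed τ i k)) ≤ ENNReal.ofReal (G ^ 2)

/-- `E[p_τ^k s_τ^k]`. -/
def meanUpdate (A : FedAvg d N Ω Ξ) (P : Measure Ω) (τ : ℕ) (k : Fin N) : ℝ :=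
  ∫ ω, A.p τ k ω * (A.s τ k ω : ℝ) ∂P

/-- `E[∑_k p_τ^k s_τ^k]`. -/
def meanTotal (A : FedAvg d N Ω Ξ) (P : Measure Ω) (τ : ℕ) : ℝ :=
  ∫ ω, ∑ k, A.p τ k ω * (A.s τ k ω : ℝ) ∂P

/-- The participation expectations that enter the bound do not vary over the `T` rounds. -/
structure TimeInvariant (A : FedAvg d N Ω Ξ) (P : Measure Ω) (T : ℕ) : Prop where
  mean_p : ∀ τ < T, ∀ k, ∫ ω, A.p τ k ω ∂P = ∫ ω, A.p 0 k ω ∂P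
  mean_ps : ∀ τ < T, ∀ k, A.meanUpdate P τ k = A.meanUpdate P 0 k
  mean_ppS : ∀ τ < T, ∀ k,
    ∫ ω, A.p τ k ω ^ 2 * (A.s τ k ω : ℝ) ∂P = ∫ ω, A.p 0 k ω ^ 2 * (A.s 0 k ω : ℝ) ∂P
  mean_excess : ∀ τ < T,
    ∫ ω, max ((∑ k, A.p τ k ω) - 2) 0 * ∑ k, A.p τ k ω * (A.s τ k ω : ℝ) ∂P =
      ∫ ω, max ((∑ k, A.p 0 k ω) - 2) 0 * ∑ k, A.p 0 k ω * (A.s 0 k ω : ℝ) ∂P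

open Classical in
/-- `z_τ ∈ {0, 1}` indicates that `E[p_τ^k s_τ^k] / p^k` does not take the same value
for all `k`. -/
def biasIndicator (A : FedAvg d N Ω Ξ) (P : Measure Ω) (τ : ℕ) : ℕ :=
  if ∃ c : ℝ, ∀ k, A.meanUpdate P τ k / A.weight k = c then 0 else 1

/-- `M_τ`, the number of rounds before `τ` with `z = 1`. -/
def biasedRounds (A : FedAvg d N Ω Ξ) (P : Measure Ω) (τ : ℕ) : ℕ :=
  ∑ t ∈ Finset.range τ, A.biasIndicator P t

/-- The constant `γ`. Here and below, the time-invariant expectations are those of round `0`. -/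
def gammaConst (A : FedAvg d N Ω Ξ) (P : Measure Ω) (L μ θ : ℝ) : ℝ :=
  max (32 * A.E * (1 + θ) * L / (μ * A.meanTotal P 0)) (4 * (A.E : ℝ) ^ 2 * θ / A.meanTotal P 0)

/-- The step size `η_τ`. -/
def stepSize (A : FedAvg d N Ω Ξ) (P : Measure Ω) (L μ θ : ℝ) (τ : ℕ) : ℝ :=
  16 * A.E / (μ * A.meanTotal P τ) * (1 / (τ * A.E + A.gammaConst P L μ θ))

/-- The constant `D`. -/
def DConst (A : FedAvg d N Ω Ξ) (P : Measure Ω) (μ : ℝ) (wStar : Param d) : ℝ :=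
  64 * A.E * (∑ k, A.meanUpdate P 0 k * A.noniid wStar k) / (μ * A.meanTotal P 0)

/-- The random variable `B_τ`. -/
def BTerm (A : FedAvg d N Ω Ξ) (L μ θ G : ℝ) (σ : Fin N → ℝ) (wStar : Param d) (τ : ℕ) (ω : Ω) :
    ℝ :=
  2 * (2 + θ) * L * ∑ k, A.p τ k ω * (A.s τ k ω : ℝ) * A.noniid wStar k
    + (2 + μ / (2 * (1 + θ) * L)) * A.E * ((A.E : ℝ) - 1) * G ^ 2 *
      (∑ k, A.p τ k ω * (A.s τ k ω : ℝ)
        + θ * max ((∑ k, A.p τ k ω) - 2) 0 * ∑ k, A.p τ k ω * (A.s τ k ω : ℝ))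
    + 2 * A.E * G ^ 2 * ∑ k, A.p τ k ω ^ 2 / A.weight k * (A.s τ k ω : ℝ)
    + ∑ k, A.p τ k ω ^ 2 * (A.s τ k ω : ℝ) * σ k ^ 2

/-- The constant `V`. -/
def VConst (A : FedAvg d N Ω Ξ) (P : Measure Ω) (L μ θ G : ℝ) (σ : Fin N → ℝ) (wStar : Param d) :
    ℝ :=
  max (A.gammaConst P L μ θ ^ 2 * ∫ ω, ‖A.w₀ ω - wStar‖ ^ 2 ∂P)
    ((16 * A.E / (μ * A.meanTotal P 0)) ^ 2 * ((∫ ω, A.BTerm L μ θ G σ wStar 0 ω ∂P) / A.E))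

end

end FedAvg

/-! Write Δ for the expected squared distance of the global weight from w* at the start of a round.
The proof is a one-round recursion for Δ, followed by the standard induction giving a 1/t rate.

With coefficients c = p · 1[i < s], a round is one step w ↦ w - η ∑_k ∑_{i<E} c g. Local SGD is
defined at all i < E, executed or not, so a device's local trajectory in a round is independent of
its participation in that round. Hence moment bounds conditioned on execution become unconditional,
and c factors out of expectations.

Expand the square. In the cross term, unbiasedness replaces g by the full gradient at the local
weight. `StrongConvexOn.le_inner_gradient` then bounds the term below by F_k(w) - F_k(w*) + μ/4 ‖w -
w*‖², up to a multiple of the local drift, whose mean square is at most η² E(E-1)G²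
(`integral_drift_le`). The quadratic term is controlled by second moments and Cauchy-Schwarz. This
gives `integral_globalWeight_succ_le`.

What is left is the sum of E[p s] (E F_k(w) - F_k(w*)). If the means E[p s] are proportional to the
weights, it is a multiple of the global suboptimality, hence nonnegative; otherwise it is at least
-∑ E[p s] Γ_k (`neg_bias_le`). So Δ' ≤ (1 - ημS/2) Δ + 2ηz ∑ E[p s] Γ_k + η² E[B], and `decay_step`
propagates the claimed bound for η = β/t. -/

set_option linter.unusedSectionVars false

/-! ### Strong convexity and smoothness in a Hilbert space. -/

section Convex

variable {H : Type*} [NormedAddCommGroup H] [InnerProductSpace ℝ H] [CompleteSpace H]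

/-- The first-order characterization of strong convexity. -/
theorem StrongConvexOn.add_inner_gradient_le {f : H → ℝ} {μ : ℝ}
    (hf : StrongConvexOn Set.univ μ f) {x : H} (hd : DifferentiableAt ℝ f x) (y : H) :
    f x + inner ℝ (gradient f x) (y - x) + μ / 2 * ‖y - x‖ ^ 2 ≤ f y := by
  have hc := strongConvexOn_iff_convex.1 hf
  set ℓ : ℝ →ᵃ[ℝ] H := AffineMap.lineMap x y with hℓ
  have hcl := hc.comp_affineMap ℓ
  have hℓ0 : ℓ 0 = x := by simp [hℓ]
  have hℓ1 : ℓ 1 = y := by simp [hℓ]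
  have hdℓ : HasDerivAt ℓ (y - x) 0 := by
    simpa [hℓ] using (AffineMap.hasDerivAt_lineMap (a := x) (b := y) (x := (0 : ℝ)))
  have hdf : HasDerivAt (fun t => f (ℓ t)) (inner ℝ (gradient f x) (y - x)) 0 := by
    have h1 : HasFDerivAt f (InnerProductSpace.toDual ℝ H (gradient f x)) (ℓ 0) := by
      rw [hℓ0]; exact hd.hasGradientAt.hasFDerivAt
    exact h1.comp_hasDerivAt (0 : ℝ) hdℓ
  have hdn : HasDerivAt (fun t => ‖ℓ t‖ ^ 2) (2 * inner ℝ x (y - x)) 0 := by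
    have := hdℓ.norm_sq
    rwa [hℓ0] at this
  have hdt : HasDerivAt ((fun z => f z - μ / 2 * ‖z‖ ^ 2) ∘ ℓ)
      (inner ℝ (gradient f x) (y - x) - μ / 2 * (2 * inner ℝ x (y - x))) 0 :=
    hdf.sub (hdn.const_mul _)
  have key := hcl.le_slope_of_hasDerivAt (Set.mem_univ (0 : ℝ)) (Set.mem_univ (1 : ℝ))
    one_pos hdt
  simp only [slope_def_field, Function.comp, hℓ0, hℓ1, sub_zero, div_one] at key
  have e1 : ‖y - x‖ ^ 2 = ‖y‖ ^ 2 - 2 * inner ℝ x y + ‖x‖ ^ 2 := by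
    rw [norm_sub_sq_real, real_inner_comm]
  rw [inner_sub_right x, real_inner_self_eq_norm_sq] at key
  rw [e1]
  linarith

/-- A differentiable strongly convex function is bounded below. -/
theorem StrongConvexOn.bddBelow_range {f : H → ℝ} {μ : ℝ} (hμ : 0 < μ)
    (hf : StrongConvexOn Set.univ μ f) {x : H} (hd : DifferentiableAt ℝ f x) :
    BddBelow (Set.range f) := by
  -- The lower bound is the minimum over r of f x - ‖∇f x‖ r + μ/2 r², where r stands for ‖y - x‖;
  -- `h3` completes the square.
  refine ⟨f x - ‖gradient f x‖ ^ 2 / (2 * μ), ?_⟩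
  rintro _ ⟨y, rfl⟩
  have h1 := hf.add_inner_gradient_le hd y
  have h2 := neg_le_of_abs_le (abs_real_inner_le_norm (gradient f x) (y - x))
  have h3 : ‖gradient f x‖ ^ 2 / (2 * μ) + μ / 2 * ‖y - x‖ ^ 2
      - ‖gradient f x‖ * ‖y - x‖ = (‖gradient f x‖ - μ * ‖y - x‖) ^ 2 / (2 * μ) := by
    field_simp
    ring
  have h4 : 0 ≤ (‖gradient f x‖ - μ * ‖y - x‖) ^ 2 / (2 * μ) := by positivity
  linarith

/-- Progress made by the gradient at `u` with respect to the base points `w` and `z`. -/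
theorem StrongConvexOn.le_inner_gradient {f : H → ℝ} {μ L : ℝ} (hμ : 0 < μ)
    (hf : StrongConvexOn Set.univ μ f) (hd : Differentiable ℝ f)
    (hL : ∀ x y, ‖gradient f x - gradient f y‖ ≤ L * ‖x - y‖) (w u z : H) :
    f w - f z + μ / 4 * ‖w - z‖ ^ 2 - (L + μ / 2) * ‖u - w‖ ^ 2
      ≤ inner ℝ (w - z) (gradient f u) := by
  have h1 := hf.add_inner_gradient_le (hd u) z
  have h2 := hf.add_inner_gradient_le (hd w) u
  have h3 : inner ℝ (gradient f w - gradient f u) (w - u) ≤ L * ‖u - w‖ ^ 2 := by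
    calc _ ≤ ‖gradient f w - gradient f u‖ * ‖w - u‖ := real_inner_le_norm _ _
      _ ≤ L * ‖w - u‖ * ‖w - u‖ := by gcongr; exact hL w u
      _ = L * ‖u - w‖ ^ 2 := by rw [norm_sub_rev]; ring
  -- Strong convexity at u yields μ/2 ‖z - u‖², but the recursion needs the distance from w. The
  -- exchange halves the constant to μ/4 and adds μ/2 to the drift coefficient.
  have h4 : ‖w - z‖ ^ 2 ≤ 2 * ‖z - u‖ ^ 2 + 2 * ‖u - w‖ ^ 2 := by
    have : ‖w - z‖ ≤ ‖z - u‖ + ‖u - w‖ := by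
      rw [norm_sub_rev w z]; exact norm_sub_le_norm_sub_add_norm_sub _ _ _
    nlinarith [sq_nonneg (‖z - u‖ - ‖u - w‖), norm_nonneg (w - z)]
  have e1 : inner ℝ (w - z) (gradient f u) = - inner ℝ (gradient f w - gradient f u) (w - u)
      - inner ℝ (gradient f w) (u - w) - inner ℝ (gradient f u) (z - u) := by
    rw [real_inner_comm]
    simp only [inner_sub_left, inner_sub_right]
    ring
  have h5 : 0 ≤ μ / 2 * ‖u - w‖ ^ 2 := by positivity
  nlinarith

/-- Quadratic growth bound for a strongly convex function with Lipschitz gradient. -/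
theorem StrongConvexOn.abs_sub_le {f : H → ℝ} {μ L : ℝ} (hμ : 0 < μ)
    (hf : StrongConvexOn Set.univ μ f) (hd : Differentiable ℝ f)
    (hL : ∀ x y, ‖gradient f x - gradient f y‖ ≤ L * ‖x - y‖) (w z : H) :
    |f w - f z| ≤ ‖gradient f z‖ * ‖w - z‖ + L * ‖w - z‖ ^ 2 := by
  have h1 := hf.add_inner_gradient_le (hd z) w
  have h2 := hf.add_inner_gradient_le (hd w) z
  have h3 := neg_le_of_abs_le (abs_real_inner_le_norm (gradient f z) (w - z))
  have h4 := neg_le_of_abs_le (abs_real_inner_le_norm (gradient f w) (z - w))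
  rw [norm_sub_rev z w] at h4 h2
  have h6 : ‖gradient f w‖ ≤ ‖gradient f z‖ + L * ‖w - z‖ := by
    have := norm_le_norm_add_norm_sub' (gradient f w) (gradient f z)
    linarith [hL w z]
  have h7 := mul_le_mul_of_nonneg_right h6 (norm_nonneg (w - z))
  have h8 : 0 ≤ μ / 2 * ‖w - z‖ ^ 2 := by positivity
  have h9 : 0 ≤ L * ‖w - z‖ * ‖w - z‖ :=
    mul_nonneg ((norm_nonneg _).trans (hL w z)) (norm_nonneg _)
  rw [abs_le]
  constructor <;> nlinarith

end Convex

/-! ### Expectations under independence. -/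

section Probability

variable {Ω : Type*} [MeasurableSpace Ω] {P : Measure Ω} [IsProbabilityMeasure P]

/-- Taking the expectation over an independent noise inside an inner product. -/
theorem ProbabilityTheory.IndepFun.integral_inner_of_mean {H Y X : Type*} [NormedAddCommGroup H]
    [InnerProductSpace ℝ H] [CompleteSpace H] [MeasurableSpace H] [BorelSpace H]
    [SecondCountableTopology H] [MeasurableSpace Y] [MeasurableSpace X]
    {V : Ω → H} {W : Ω → Y} {ξ : Ω → X} {g : Y → X → H} {m : Y → H}
    (hV : Measurable V) (hW : Measurable W) (hξ : Measurable ξ)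
    (hg : Measurable (fun z : Y × X => g z.1 z.2))
    (hind : IndepFun (fun ω => (V ω, W ω)) ξ P)
    (hm : ∀ y, Integrable (fun ω => g y (ξ ω)) P ∧ ∫ ω, g y (ξ ω) ∂P = m y)
    (hint : Integrable (fun ω => inner ℝ (V ω) (g (W ω) (ξ ω))) P) :
    Integrable (fun ω => inner ℝ (V ω) (m (W ω))) P ∧
      ∫ ω, inner ℝ (V ω) (g (W ω) (ξ ω)) ∂P = ∫ ω, inner ℝ (V ω) (m (W ω)) ∂P := by
  have hVW : Measurable (fun ω => (V ω, W ω)) := hV.prodMk hW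
  set φ : (H × Y) × X → ℝ := fun z => inner ℝ z.1.1 (g z.1.2 z.2) with hφ
  have hφm : Measurable φ :=
    (measurable_fst.comp measurable_fst).inner
      (hg.comp ((measurable_snd.comp measurable_fst).prodMk measurable_snd))
  have hlaw := hind.map_prod_eq_prod_map_map hVW.aemeasurable hξ.aemeasurable
  have hpair : Measurable (fun ω => ((V ω, W ω), ξ ω)) := hVW.prodMk hξ
  have := Measure.isProbabilityMeasure_map (μ := P) hVW.aemeasurable
  have := Measure.isProbabilityMeasure_map (μ := P) hξ.aemeasurable
  have hφint : Integrable φ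
      ((P.map (fun ω => (V ω, W ω))).prod (P.map ξ)) := by
    rw [← hlaw, integrable_map_measure hφm.aestronglyMeasurable hpair.aemeasurable]
    exact hint
  have hinner : ∀ a : H × Y, ∫ x, φ (a, x) ∂(P.map ξ) = inner ℝ a.1 (m a.2) := by
    intro a
    have h1 : Measurable (fun x => φ (a, x)) := hφm.comp measurable_prodMk_left
    rw [integral_map hξ.aemeasurable h1.aestronglyMeasurable]
    simp only [hφ]
    rw [integral_inner (hm a.2).1, (hm a.2).2]
  -- Fubini also supplies the integrability of the averaged inner product, so no moment of `m` along
  -- `W` has to be assumed.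
  have hI := hφint.integral_prod_left
  simp only [hinner] at hI
  refine ⟨(integrable_map_measure hI.aestronglyMeasurable hVW.aemeasurable).1 hI, ?_⟩
  calc ∫ ω, inner ℝ (V ω) (g (W ω) (ξ ω)) ∂P
      = ∫ z, φ z ∂(P.map (fun ω => ((V ω, W ω), ξ ω))) :=
        (integral_map hpair.aemeasurable hφm.aestronglyMeasurable).symm
    _ = ∫ a, inner ℝ a.1 (m a.2) ∂(P.map (fun ω => (V ω, W ω))) := by
        rw [hlaw, integral_prod _ hφint]
        simp only [hinner]
    _ = _ := integral_map hVW.aemeasurable hI.aestronglyMeasurable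

/-- Conditioning on an independent event does not change an expectation. -/
theorem ProbabilityTheory.lintegral_cond_eq_of_indep {Y : Type*} [MeasurableSpace Y]
    {f : Ω → ENNReal} {X : Ω → Y} {t : Set Y} (hf : Measurable f) (hX : Measurable X)
    (ht : MeasurableSet t) (hind : IndepFun f X P) (hpos : P (X ⁻¹' t) ≠ 0) :
    ∫⁻ ω, f ω ∂(cond P (X ⁻¹' t)) = ∫⁻ ω, f ω ∂P := by
  have hs : MeasurableSet (X ⁻¹' t) := hX ht
  have hi : Measurable (t.indicator (fun _ => (1 : ENNReal))) :=
    measurable_const.indicator ht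
  have h1 := lintegral_mul_eq_lintegral_mul_lintegral_of_indepFun hf (hi.comp hX)
    (hind.comp measurable_id hi)
  have h2 : ∀ ω, (f * (t.indicator (fun _ => (1 : ENNReal)) ∘ X)) ω
      = (X ⁻¹' t).indicator f ω := by
    intro ω
    by_cases h : X ω ∈ t <;> simp [h]
  have h3 : ∀ ω, (t.indicator (fun _ => (1 : ENNReal)) ∘ X) ω
      = (X ⁻¹' t).indicator 1 ω := by
    intro ω
    by_cases h : X ω ∈ t <;> simp [h]
  simp only [h2, h3, lintegral_indicator hs, Pi.one_apply, lintegral_one,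
    Measure.restrict_apply_univ] at h1
  rw [cond, lintegral_smul_measure, h1, smul_eq_mul, mul_comm, mul_assoc,
    ENNReal.mul_inv_cancel hpos (measure_ne_top _ _), mul_one]

end Probability

namespace FedAvg

noncomputable section

/-- The coefficient of the gradient of device `k` at time step `τ E + i` in the aggregate:
it vanishes if the local update is not carried out. -/
def stepCoeff {d N : ℕ} {Ω : Type*} {Ξ : Fin N → Type*} (A : FedAvg d N Ω Ξ) (τ i : ℕ)
    (k : Fin N) (ω : Ω) : ℝ :=
  A.p τ k ω * if i < A.s τ k ω then 1 else 0

/-! ### A round as a single aggregated gradient step. -/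

section Deterministic

variable {d N : ℕ} {Ω : Type*} {Ξ : Fin N → Type*} (A : FedAvg d N Ω Ξ) (η : ℕ → ℝ)

theorem localWeight_zero (τ : ℕ) (k : Fin N) (ω : Ω) :
    A.localWeight η τ 0 k ω = A.globalWeight η τ ω := rfl

theorem localWeight_succ (τ i : ℕ) (k : Fin N) (ω : Ω) :
    A.localWeight η τ (i + 1) k ω
      = A.localWeight η τ i k ω - η τ • A.stochGrad η τ i k ω := rfl

theorem localWeight_eq (τ i : ℕ) (k : Fin N) (ω : Ω) :
    A.localWeight η τ i k ω
      = A.globalWeight η τ ω - η τ • ∑ j ∈ Finset.range i, A.stochGrad η τ j k ω := by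
  induction i with
  | zero => simp [localWeight_zero]
  | succ i ih => rw [localWeight_succ, ih, Finset.sum_range_succ, smul_add, sub_sub]

/-- The indicator in `stepCoeff` cuts the sum off at s, which is at most E. A sum of random length
becomes one of fixed length, through which expectations can be taken termwise. -/
theorem sum_stepCoeff_smul {M : Type*} [AddCommGroup M] [Module ℝ M] {τ : ℕ} {k : Fin N}
    {ω : Ω} (hs : A.s τ k ω ≤ A.E) (f : ℕ → M) :
    ∑ i ∈ Finset.range A.E, A.stepCoeff τ i k ω • f i
      = A.p τ k ω • ∑ i ∈ Finset.range (A.s τ k ω), f i := by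
  simp only [stepCoeff, mul_smul, ← Finset.smul_sum]
  congr 1
  rw [← Finset.sum_subset (Finset.range_subset_range.2 hs)]
  · exact Finset.sum_congr rfl fun i hi => by simp [Finset.mem_range.1 hi]
  · intro i _ hi
    rw [Finset.mem_range] at hi
    simp [hi]

theorem globalWeight_succ {τ : ℕ} {ω : Ω} (hs : ∀ k, A.s τ k ω ≤ A.E) :
    A.globalWeight η (τ + 1) ω = A.globalWeight η τ ω
      - η τ • ∑ k, ∑ i ∈ Finset.range A.E, A.stepCoeff τ i k ω • A.stochGrad η τ i k ω := by
  have h1 : A.globalWeight η (τ + 1) ω = A.globalWeight η τ ω + ∑ k, A.p τ k ω •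
      (A.localWeight η τ (A.s τ k ω) k ω - A.globalWeight η τ ω) := rfl
  rw [h1, sub_eq_add_neg, ← smul_neg, ← Finset.sum_neg_distrib, Finset.smul_sum]
  congr 1
  refine Finset.sum_congr rfl fun k _ => ?_
  rw [sum_stepCoeff_smul A (hs k), localWeight_eq, sub_sub_cancel_left, smul_neg, smul_neg,
    smul_comm]

end Deterministic

/-! ### Measurability of the weights, over an arbitrary σ-algebra. -/

section Measurability

variable {d N : ℕ} {Ω : Type*} {Ξ : Fin N → Type*} [∀ k, MeasurableSpace (Ξ k)]
  {mΩ : MeasurableSpace Ω} {A : FedAvg d N Ω Ξ} {η : ℕ → ℝ}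

/-- The σ-algebra on `Ω` is left free and only the random inputs actually used are required to be
measurable. The same induction thus serves the ambient σ-algebra and those generated by subfamilies
of the sources. -/
theorem measurable_localWeight
    (hg : ∀ k, Measurable (fun x : Param d × Ξ k => A.g k x.1 x.2)) {τ : ℕ} {k : Fin N}
    (hw : Measurable (A.globalWeight η τ)) {i : ℕ} (hξ : ∀ j < i, Measurable (A.ξ τ j k)) :
    Measurable (A.localWeight η τ i k) := by
  induction i with
  | zero => exact hw
  | succ i ih =>
    have h1 := ih fun j hj => hξ j (hj.trans (Nat.lt_succ_self i))
    exact h1.sub (((hg k).comp (h1.prodMk (hξ i (Nat.lt_succ_self i)))).const_smul (η τ))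

theorem measurable_stochGrad
    (hg : ∀ k, Measurable (fun x : Param d × Ξ k => A.g k x.1 x.2)) {τ : ℕ} {k : Fin N}
    (hw : Measurable (A.globalWeight η τ)) {i : ℕ} (hξ : ∀ j ≤ i, Measurable (A.ξ τ j k)) :
    Measurable (A.stochGrad η τ i k) :=
  (hg k).comp ((measurable_localWeight hg hw fun j hj => hξ j hj.le).prodMk (hξ i le_rfl))

theorem measurable_stepCoeff {τ : ℕ} {k : Fin N} (hp : Measurable (A.p τ k))
    (hs : Measurable (A.s τ k)) (i : ℕ) : Measurable (A.stepCoeff τ i k) :=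
  hp.mul (Measurable.ite (measurableSet_lt measurable_const hs) measurable_const
    measurable_const)

theorem measurable_globalWeight
    (hg : ∀ k, Measurable (fun x : Param d × Ξ k => A.g k x.1 x.2)) {τ : ℕ}
    (hw₀ : Measurable A.w₀) (hs : ∀ t < τ, ∀ k ω, A.s t k ω ≤ A.E)
    (hpm : ∀ t < τ, ∀ k, Measurable (A.p t k)) (hsm : ∀ t < τ, ∀ k, Measurable (A.s t k))
    (hξ : ∀ t < τ, ∀ i < A.E, ∀ k, Measurable (A.ξ t i k)) :
    Measurable (A.globalWeight η τ) := by
  induction τ with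
  | zero => exact hw₀
  | succ τ ih =>
    have hτ := Nat.lt_succ_self τ
    have h1 := ih (fun t ht => hs t (ht.trans hτ)) (fun t ht => hpm t (ht.trans hτ))
      (fun t ht => hsm t (ht.trans hτ)) (fun t ht => hξ t (ht.trans hτ))
    have h2 : A.globalWeight η (τ + 1) = fun ω => A.globalWeight η τ ω
        - η τ • ∑ k, ∑ i ∈ Finset.range A.E, A.stepCoeff τ i k ω • A.stochGrad η τ i k ω :=
      funext fun ω => globalWeight_succ A η fun k => hs τ hτ k ω
    rw [h2]
    have h3 : Measurable fun ω => ∑ k, ∑ i ∈ Finset.range A.E,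
        A.stepCoeff τ i k ω • A.stochGrad η τ i k ω := by
      refine Finset.measurable_fun_sum _ fun k _ => Finset.measurable_fun_sum _ fun i hi => ?_
      exact (measurable_stepCoeff (hpm τ hτ k) (hsm τ hτ k) i).smul
        (measurable_stochGrad hg h1 fun j hj =>
          hξ τ hτ j (hj.trans_lt (Finset.mem_range.1 hi)) k)
    exact h1.sub (h3.const_smul (η τ))

end Measurability

/-! ### Independence between participation, mini-batches and weights. -/

namespace IsModel

variable {d N T : ℕ} {Ω : Type*} {Ξ : Fin N → Type*} [MeasurableSpace Ω]
  [∀ k, MeasurableSpace (Ξ k)] {P : Measure Ω} {A : FedAvg d N Ω Ξ} {η : ℕ → ℝ}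

theorem measurable_globalWeight (hA : A.IsModel P T) {τ : ℕ} (hτ : τ ≤ T) :
    Measurable (A.globalWeight η τ) :=
  FedAvg.measurable_globalWeight hA.measurable_g hA.measurable_w₀
    (fun t ht => hA.s_le t (ht.trans_le hτ)) (fun t ht => hA.measurable_p t (ht.trans_le hτ))
    (fun t ht => hA.measurable_s t (ht.trans_le hτ))
    (fun t ht => hA.measurable_ξ t (ht.trans_le hτ))

theorem measurable_localWeight (hA : A.IsModel P T) {τ : ℕ} (hτ : τ < T) {i : ℕ} (hi : i ≤ A.E)
    (k : Fin N) : Measurable (A.localWeight η τ i k) :=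
  FedAvg.measurable_localWeight hA.measurable_g (hA.measurable_globalWeight hτ.le)
    fun j hj => hA.measurable_ξ τ hτ j (hj.trans_le hi) k

theorem measurable_stochGrad (hA : A.IsModel P T) {τ : ℕ} (hτ : τ < T) {i : ℕ} (hi : i < A.E)
    (k : Fin N) : Measurable (A.stochGrad η τ i k) :=
  FedAvg.measurable_stochGrad hA.measurable_g (hA.measurable_globalWeight hτ.le)
    fun j hj => hA.measurable_ξ τ hτ j (hj.trans_lt hi) k

theorem measurable_stepCoeff (hA : A.IsModel P T) {τ : ℕ} (hτ : τ < T) (i : ℕ) (k : Fin N) :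
    Measurable (A.stepCoeff τ i k) :=
  FedAvg.measurable_stepCoeff (hA.measurable_p τ hτ k) (hA.measurable_s τ hτ k) i

theorem sourceSigma_le (hA : A.IsModel P T) (r : RandomSource N T A.E) :
    A.sourceSigma T r ≤ ‹MeasurableSpace Ω› := by
  cases r with
  | init => exact hA.measurable_w₀.comap_le
  | participation τ =>
    exact (measurable_pi_lambda _ fun k =>
      (hA.measurable_p τ τ.2 k).prodMk (hA.measurable_s τ τ.2 k)).comap_le
  | batch τ i k => exact (hA.measurable_ξ τ τ.2 i i.2 k).comap_le

/-- A function of one source is independent of a function of the other sources. -/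
theorem indepFun_of_source (hA : A.IsModel P T) (r : RandomSource N T A.E) {α β : Type*}
    [mα : MeasurableSpace α] [mβ : MeasurableSpace β] {f : Ω → α} {h : Ω → β}
    (hf : Measurable[A.sourceSigma T r] f)
    (hh : Measurable[⨆ r' ∈ ({r}ᶜ : Set (RandomSource N T A.E)), A.sourceSigma T r'] h) :
    IndepFun f h P := by
  have h1 := indep_iSup_of_disjoint hA.sourceSigma_le hA.indep
    (disjoint_compl_right (a := ({r} : Set (RandomSource N T A.E))))
  rw [iSup_singleton] at h1
  exact indep_of_indep_of_le_left (indep_of_indep_of_le_right h1 hh.comap_le) hf.comap_le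

/-- Each source is measurable for the σ-algebra of a family of sources it belongs to. -/
theorem _root_.FedAvg.sourceSigma_le_iSup (A : FedAvg d N Ω Ξ)
    {I : Set (RandomSource N T A.E)} {r : RandomSource N T A.E} (hr : r ∈ I) :
    A.sourceSigma T r ≤ ⨆ r' ∈ I, A.sourceSigma T r' :=
  le_iSup₂ (f := fun r' (_ : r' ∈ I) => A.sourceSigma T r') r hr

theorem _root_.FedAvg.measurable_participation_p (A : FedAvg d N Ω Ξ) (τ : Fin T) (k : Fin N) :
    Measurable[A.sourceSigma T (.participation τ)] (A.p τ k) :=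
  have h : Measurable fun x : Fin N → ℝ × ℕ => (x k).1 :=
    measurable_fst.comp (measurable_pi_apply k)
  h.comp (comap_measurable (fun ω (k : Fin N) => (A.p τ k ω, A.s τ k ω)))

theorem _root_.FedAvg.measurable_participation_s (A : FedAvg d N Ω Ξ) (τ : Fin T) (k : Fin N) :
    Measurable[A.sourceSigma T (.participation τ)] (A.s τ k) :=
  have h : Measurable fun x : Fin N → ℝ × ℕ => (x k).2 :=
    measurable_snd.comp (measurable_pi_apply k)
  h.comp (comap_measurable (fun ω (k : Fin N) => (A.p τ k ω, A.s τ k ω)))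

/-- The global weight is determined by the sources of the earlier rounds. -/
theorem measurable_globalWeight_iSup (hA : A.IsModel P T) {τ : ℕ} (hτ : τ ≤ T)
    {I : Set (RandomSource N T A.E)} (hinit : .init ∈ I)
    (hpart : ∀ t : Fin T, t < τ → .participation t ∈ I)
    (hbatch : ∀ t : Fin T, t < τ → ∀ i k, .batch t i k ∈ I) :
    Measurable[⨆ r ∈ I, A.sourceSigma T r] (A.globalWeight η τ) := by
  refine FedAvg.measurable_globalWeight hA.measurable_g ?_
    (fun t ht => hA.s_le t (ht.trans_le hτ)) ?_ ?_ ?_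
  · exact (comap_measurable A.w₀).mono (A.sourceSigma_le_iSup hinit) le_rfl
  · exact fun t ht k => (A.measurable_participation_p ⟨t, ht.trans_le hτ⟩ k).mono
      (A.sourceSigma_le_iSup (hpart ⟨t, ht.trans_le hτ⟩ ht)) le_rfl
  · exact fun t ht k => (A.measurable_participation_s ⟨t, ht.trans_le hτ⟩ k).mono
      (A.sourceSigma_le_iSup (hpart ⟨t, ht.trans_le hτ⟩ ht)) le_rfl
  · exact fun t ht i hi k => (comap_measurable (A.ξ t i k)).mono
      (A.sourceSigma_le_iSup (hbatch ⟨t, ht.trans_le hτ⟩ ht ⟨i, hi⟩ k)) le_rfl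

/-- The participation of a round is independent of the stochastic gradients and the local weights
of this round. -/
theorem indepFun_participation_local (hA : A.IsModel P T) {τ : ℕ} (hτ : τ < T) {i : ℕ}
    (hi : i < A.E) (k : Fin N) :
    IndepFun (fun ω => (A.p τ k ω, A.s τ k ω))
      (fun ω => (A.globalWeight η τ ω, A.localWeight η τ i k ω, A.stochGrad η τ i k ω)) P := by
  refine hA.indepFun_of_source (.participation ⟨τ, hτ⟩)
    ((A.measurable_participation_p ⟨τ, hτ⟩ k).prodMk
      (A.measurable_participation_s ⟨τ, hτ⟩ k)) ?_
  have hw : Measurable[⨆ r' ∈ ({.participation ⟨τ, hτ⟩}ᶜ : Set (RandomSource N T A.E)),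
      A.sourceSigma T r'] (A.globalWeight η τ) := by
    refine hA.measurable_globalWeight_iSup hτ.le (by simp) ?_ (by simp)
    -- The weight at the start of round τ involves participations of strictly earlier rounds only,
    -- so the excluded source is never met.
    intro t ht
    simp only [Set.mem_compl_iff, Set.mem_singleton_iff, RandomSource.participation.injEq]
    rintro rfl
    exact lt_irrefl _ ht
  have hξ : ∀ j ≤ i, Measurable[⨆ r' ∈ ({.participation ⟨τ, hτ⟩}ᶜ :
      Set (RandomSource N T A.E)), A.sourceSigma T r'] (A.ξ τ j k) := fun j hj =>
    (comap_measurable (A.ξ τ j k)).mono (A.sourceSigma_le_iSup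
      (r := .batch ⟨τ, hτ⟩ ⟨j, hj.trans_lt hi⟩ k) (by simp)) le_rfl
  exact hw.prodMk ((FedAvg.measurable_localWeight hA.measurable_g hw fun j hj => hξ j hj.le).prodMk
    (FedAvg.measurable_stochGrad hA.measurable_g hw hξ))

/-- A mini-batch is independent of the participation of its round and of the weights before. -/
theorem indepFun_batch (hA : A.IsModel P T) {τ : ℕ} (hτ : τ < T) {i : ℕ} (hi : i < A.E)
    (k : Fin N) :
    IndepFun (fun ω => (A.stepCoeff τ i k ω, A.globalWeight η τ ω, A.localWeight η τ i k ω))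
      (A.ξ τ i k) P := by
  refine (hA.indepFun_of_source (.batch ⟨τ, hτ⟩ ⟨i, hi⟩ k)
    (comap_measurable (A.ξ τ i k)) ?_).symm
  have hw : Measurable[⨆ r' ∈ ({.batch ⟨τ, hτ⟩ ⟨i, hi⟩ k}ᶜ : Set (RandomSource N T A.E)),
      A.sourceSigma T r'] (A.globalWeight η τ) := by
    refine hA.measurable_globalWeight_iSup hτ.le (by simp) (by simp) ?_
    intro t ht j l
    simp only [Set.mem_compl_iff, Set.mem_singleton_iff, RandomSource.batch.injEq]
    rintro ⟨rfl, -⟩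
    exact lt_irrefl _ ht
  have hpart := A.sourceSigma_le_iSup (T := T)
    (I := ({.batch ⟨τ, hτ⟩ ⟨i, hi⟩ k}ᶜ : Set (RandomSource N T A.E)))
    (r := .participation ⟨τ, hτ⟩) (by simp)
  refine Measurable.prodMk (FedAvg.measurable_stepCoeff
    ((A.measurable_participation_p ⟨τ, hτ⟩ k).mono hpart le_rfl)
    ((A.measurable_participation_s ⟨τ, hτ⟩ k).mono hpart le_rfl) i)
    (hw.prodMk (FedAvg.measurable_localWeight hA.measurable_g hw fun j hj => ?_))
  exact (comap_measurable (A.ξ τ j k)).mono (A.sourceSigma_le_iSup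
    (r := .batch ⟨τ, hτ⟩ ⟨j, hj.trans hi⟩ k) (by simp [hj.ne])) le_rfl

end IsModel

end

end FedAvg

/-! ### Algebra of the aggregate and its coefficients. -/

/-- Cauchy-Schwarz twice: with equal weights over the steps, which costs n, and with weights q over
the index k. Taking q to be the device weights produces the terms (p_τ^k)²/p^k of B. -/
theorem norm_sum_sum_sq_le {ι H : Type*} [NormedAddCommGroup H] (s : Finset ι) (n : ℕ)
    (u : ι → ℕ → H) {q : ι → ℝ} (hq : ∀ k ∈ s, 0 < q k) (hsum : ∑ k ∈ s, q k = 1) :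
    ‖∑ k ∈ s, ∑ i ∈ Finset.range n, u k i‖ ^ 2
      ≤ n * ∑ k ∈ s, (∑ i ∈ Finset.range n, ‖u k i‖ ^ 2) / q k := by
  have h1 : ∀ k, (∑ i ∈ Finset.range n, ‖u k i‖) ^ 2
      ≤ n * ∑ i ∈ Finset.range n, ‖u k i‖ ^ 2 := fun k => by
    simpa using sq_sum_le_card_mul_sum_sq (s := Finset.range n) (f := fun i => ‖u k i‖)
  calc ‖∑ k ∈ s, ∑ i ∈ Finset.range n, u k i‖ ^ 2
      ≤ (∑ k ∈ s, ∑ i ∈ Finset.range n, ‖u k i‖) ^ 2 := by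
        gcongr
        exact (norm_sum_le _ _).trans (Finset.sum_le_sum fun k _ => norm_sum_le _ _)
    _ ≤ ∑ k ∈ s, (∑ i ∈ Finset.range n, ‖u k i‖) ^ 2 / q k := by
        simpa [hsum] using Finset.sq_sum_div_le_sum_sq_div s
          (fun k => ∑ i ∈ Finset.range n, ‖u k i‖) hq
    _ ≤ ∑ k ∈ s, n * ((∑ i ∈ Finset.range n, ‖u k i‖ ^ 2) / q k) := by
        refine Finset.sum_le_sum fun k hk => ?_
        rw [← mul_div_assoc]
        exact div_le_div_of_nonneg_right (h1 k) (hq k hk).le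
    _ = _ := by rw [Finset.mul_sum]

namespace FedAvg

noncomputable section

section Deterministic

variable {d N : ℕ} {Ω : Type*} {Ξ : Fin N → Type*} (A : FedAvg d N Ω Ξ)

theorem sum_stepCoeff {τ : ℕ} {k : Fin N} {ω : Ω} (hs : A.s τ k ω ≤ A.E) :
    ∑ i ∈ Finset.range A.E, A.stepCoeff τ i k ω = A.p τ k ω * (A.s τ k ω : ℝ) := by
  simpa using A.sum_stepCoeff_smul hs (fun _ => (1 : ℝ))

theorem stepCoeff_sq (τ i : ℕ) (k : Fin N) (ω : Ω) :
    A.stepCoeff τ i k ω ^ 2 = A.p τ k ω * A.stepCoeff τ i k ω := by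
  unfold stepCoeff
  split_ifs <;> ring

theorem sum_stepCoeff_sq {τ : ℕ} {k : Fin N} {ω : Ω} (hs : A.s τ k ω ≤ A.E) :
    ∑ i ∈ Finset.range A.E, A.stepCoeff τ i k ω ^ 2 = A.p τ k ω ^ 2 * (A.s τ k ω : ℝ) := by
  simp only [stepCoeff_sq, ← Finset.mul_sum, A.sum_stepCoeff hs]
  ring

theorem abs_stepCoeff_le (τ i : ℕ) (k : Fin N) (ω : Ω) :
    |A.stepCoeff τ i k ω| ≤ |A.p τ k ω| := by
  unfold stepCoeff
  split_ifs <;> simp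

end Deterministic

/-! ### Moment bounds and the one-round recursion. -/

namespace IsModel

variable {d N T : ℕ} {Ω : Type*} {Ξ : Fin N → Type*} [MeasurableSpace Ω]
  [∀ k, MeasurableSpace (Ξ k)] {P : Measure Ω} {A : FedAvg d N Ω Ξ} {η : ℕ → ℝ}

theorem weight_pos (hA : A.IsModel P T) (k : Fin N) : 0 < A.weight k :=
  div_pos (Nat.cast_pos.2 (hA.n_pos k))
    (Finset.sum_pos (fun j _ => Nat.cast_pos.2 (hA.n_pos j)) ⟨k, Finset.mem_univ k⟩)

theorem sum_weight (hA : A.IsModel P T) [Nonempty (Fin N)] : ∑ k, A.weight k = 1 := by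
  unfold weight
  rw [← Finset.sum_div]
  exact div_self (Finset.sum_pos (fun j _ => Nat.cast_pos.2 (hA.n_pos j))
    Finset.univ_nonempty).ne'

theorem ae_abs_p_le (hA : A.IsModel P T) {θ : ℝ}
    (hθ : ∀ τ < T, ∀ k, ∀ᵐ ω ∂P, A.p τ k ω / A.weight k ≤ θ) {τ : ℕ} (hτ : τ < T)
    (k : Fin N) : ∀ᵐ ω ∂P, |A.p τ k ω| ≤ θ * A.weight k := by
  filter_upwards [hA.p_nonneg τ hτ k, hθ τ hτ k] with ω h1 h2
  rw [abs_of_nonneg h1]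
  exact (div_le_iff₀ (hA.weight_pos k)).1 h2

variable [IsProbabilityMeasure P]

theorem integrable_stepCoeff (hA : A.IsModel P T) {C : ℝ} {τ : ℕ} (hτ : τ < T) (i : ℕ)
    {k : Fin N} (hC : ∀ᵐ ω ∂P, |A.p τ k ω| ≤ C) : Integrable (A.stepCoeff τ i k) P :=
  .of_bound (hA.measurable_stepCoeff hτ i k).aestronglyMeasurable C
    (hC.mono fun ω h => (A.abs_stepCoeff_le τ i k ω).trans h)

theorem integrable_stepCoeff_sq (hA : A.IsModel P T) {C : ℝ} {τ : ℕ} (hτ : τ < T) (i : ℕ)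
    {k : Fin N} (hC : ∀ᵐ ω ∂P, |A.p τ k ω| ≤ C) :
    Integrable (fun ω => A.stepCoeff τ i k ω ^ 2) P :=
  .of_bound ((hA.measurable_stepCoeff hτ i k).pow_const 2).aestronglyMeasurable (C ^ 2)
    (hC.mono fun ω h => by
      rw [Real.norm_eq_abs, abs_pow]
      exact pow_le_pow_left₀ (abs_nonneg _) ((A.abs_stepCoeff_le τ i k ω).trans h) 2)

/-- Handles steps that are almost surely not executed: the conditional moment bounds say nothing
there, but such steps do not contribute to the aggregate. -/
theorem stepCoeff_ae_eq_zero {τ i : ℕ} {k : Fin N} (h : P (A.executed τ i k) = 0) :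
    A.stepCoeff τ i k =ᵐ[P] 0 := by
  have : ∀ᵐ ω ∂P, ω ∉ A.executed τ i k := measure_eq_zero_iff_ae_notMem.1 h
  filter_upwards [this] with ω hω
  have : ¬ i < A.s τ k ω := hω
  simp [stepCoeff, this]

theorem indepFun_stepCoeff_local (hA : A.IsModel P T) {τ : ℕ} (hτ : τ < T) {i : ℕ}
    (hi : i < A.E) (k : Fin N) :
    IndepFun (A.stepCoeff τ i k)
      (fun ω => (A.globalWeight η τ ω, A.localWeight η τ i k ω, A.stochGrad η τ i k ω)) P := by
  have hφ : Measurable fun x : ℝ × ℕ => x.1 * if i < x.2 then (1 : ℝ) else 0 :=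
    measurable_fst.mul (Measurable.ite (measurableSet_lt measurable_const measurable_snd)
      measurable_const measurable_const)
  exact (hA.indepFun_participation_local hτ hi k).comp hφ measurable_id

/-- The gradient is independent of s, so conditioning on i < s leaves its second moment unchanged
and the assumed bound holds under P itself. -/
theorem memLp_stochGrad (hA : A.IsModel P T) {G : ℝ} (hmom : A.BoundedSecondMoment P T η G)
    {τ : ℕ} (hτ : τ < T) {i : ℕ} (hi : i < A.E) {k : Fin N} (hpos : P (A.executed τ i k) ≠ 0) :
    MemLp (A.stochGrad η τ i k) 2 P ∧ ∫ ω, ‖A.stochGrad η τ i k ω‖ ^ 2 ∂P ≤ G ^ 2 := by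
  have hm := hA.measurable_stochGrad (η := η) hτ hi k
  have h1 := hmom τ hτ i hi k
  have hind : IndepFun (fun ω => ‖A.stochGrad η τ i k ω‖ₑ ^ 2) (A.s τ k) P := by
    have hφ : Measurable fun x : Param d × Param d × Param d => ‖x.2.2‖ₑ ^ 2 := by fun_prop
    exact ((hA.indepFun_participation_local hτ hi k).comp measurable_snd hφ).symm
  have h2 := lintegral_cond_eq_of_indep (t := Set.Ioi i) (hm.enorm.pow_const 2)
    (hA.measurable_s τ hτ k) measurableSet_Ioi hind hpos
  have h3 : ∫⁻ ω, ‖A.stochGrad η τ i k ω‖ₑ ^ 2 ∂P ≤ ENNReal.ofReal (G ^ 2) := by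
    rw [← h2]; exact h1
  have he : ∀ ω, ‖‖A.stochGrad η τ i k ω‖ ^ 2‖ₑ = ‖A.stochGrad η τ i k ω‖ₑ ^ 2 := fun ω => by
    rw [enorm_pow, enorm_norm]
  have hint : Integrable (fun ω => ‖A.stochGrad η τ i k ω‖ ^ 2) P := by
    refine ⟨(hm.norm.pow_const 2).aestronglyMeasurable, ?_⟩
    rw [HasFiniteIntegral]
    simp only [he]
    exact h3.trans_lt ENNReal.ofReal_lt_top
  refine ⟨(memLp_two_iff_integrable_sq_norm hm.aestronglyMeasurable).2 hint, ?_⟩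
  rw [← ENNReal.ofReal_le_ofReal_iff (sq_nonneg G),
    ofReal_integral_eq_lintegral_ofReal hint (.of_forall fun ω => by positivity)]
  simpa only [ENNReal.ofReal_pow (norm_nonneg _), ofReal_norm] using h3

/-- The second moment of a local update, weighted by its coefficient in the aggregate. -/
theorem memLp_stepCoeff_smul (hA : A.IsModel P T) {G C : ℝ}
    (hmom : A.BoundedSecondMoment P T η G) {τ : ℕ} (hτ : τ < T) {i : ℕ} (hi : i < A.E)
    {k : Fin N} (hC : ∀ᵐ ω ∂P, |A.p τ k ω| ≤ C) :
    MemLp (fun ω => A.stepCoeff τ i k ω • A.stochGrad η τ i k ω) 2 P ∧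
      ∫ ω, ‖A.stepCoeff τ i k ω • A.stochGrad η τ i k ω‖ ^ 2 ∂P
        ≤ (∫ ω, A.stepCoeff τ i k ω ^ 2 ∂P) * G ^ 2 := by
  have hm : Measurable fun ω => A.stepCoeff τ i k ω • A.stochGrad η τ i k ω :=
    (hA.measurable_stepCoeff hτ i k).smul (hA.measurable_stochGrad hτ hi k)
  by_cases hpos : P (A.executed τ i k) = 0
  · have h0 := stepCoeff_ae_eq_zero hpos
    have h1 : (fun ω => A.stepCoeff τ i k ω • A.stochGrad η τ i k ω) =ᵐ[P] 0 := by
      filter_upwards [h0] with ω hω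
      simp [hω]
    refine ⟨(memLp_congr_ae h1).2 MemLp.zero, ?_⟩
    rw [integral_eq_zero_of_ae]
    · exact mul_nonneg (integral_nonneg fun ω => sq_nonneg _) (sq_nonneg _)
    · filter_upwards [h1] with ω hω
      rw [hω]
      simp
  · obtain ⟨h1, h2⟩ := hA.memLp_stochGrad hmom hτ hi hpos
    have hφ : Measurable fun x : Param d × Param d × Param d => ‖x.2.2‖ ^ 2 := by fun_prop
    have hind : IndepFun (fun ω => A.stepCoeff τ i k ω ^ 2)
        (fun ω => ‖A.stochGrad η τ i k ω‖ ^ 2) P :=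
      (hA.indepFun_stepCoeff_local hτ hi k).comp (measurable_id.pow_const 2) hφ
    have hsq := hA.integrable_stepCoeff_sq hτ i hC
    have he : ∀ ω, ‖A.stepCoeff τ i k ω • A.stochGrad η τ i k ω‖ ^ 2
        = A.stepCoeff τ i k ω ^ 2 * ‖A.stochGrad η τ i k ω‖ ^ 2 := fun ω => by
      rw [norm_smul, mul_pow, Real.norm_eq_abs, sq_abs]
    have hg := (memLp_two_iff_integrable_sq_norm h1.1).1 h1
    refine ⟨(memLp_two_iff_integrable_sq_norm hm.aestronglyMeasurable).2 ?_, ?_⟩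
    · simp only [he]
      exact hind.integrable_mul hsq hg
    · simp only [he]
      rw [hind.integral_fun_mul_eq_mul_integral hsq.1 hg.1]
      exact mul_le_mul_of_nonneg_left h2 (integral_nonneg fun ω => sq_nonneg _)

/-- The distance of a local weight from the weight at the start of the round. -/
theorem integral_drift_le (hA : A.IsModel P T) {G : ℝ} (hmom : A.BoundedSecondMoment P T η G)
    {τ : ℕ} (hτ : τ < T) {i : ℕ} (hi : i < A.E) {k : Fin N} (hpos : P (A.executed τ i k) ≠ 0) :
    Integrable (fun ω => ‖A.localWeight η τ i k ω - A.globalWeight η τ ω‖ ^ 2) P ∧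
      ∫ ω, ‖A.localWeight η τ i k ω - A.globalWeight η τ ω‖ ^ 2 ∂P
        ≤ η τ ^ 2 * (i : ℝ) ^ 2 * G ^ 2 := by
  have hg : ∀ j ∈ Finset.range i, MemLp (A.stochGrad η τ j k) 2 P ∧
      ∫ ω, ‖A.stochGrad η τ j k ω‖ ^ 2 ∂P ≤ G ^ 2 := fun j hj => by
    have hj' := Finset.mem_range.1 hj
    refine hA.memLp_stochGrad hmom hτ (hj'.trans hi) fun h0 => hpos ?_
    -- Executing step i entails executing every j < i, so the earlier steps also have positive
    -- probability and their moment bounds apply.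
    exact measure_mono_null (fun ω (hω : i < A.s τ k ω) => hj'.trans hω) h0
  have hint : ∀ j ∈ Finset.range i, Integrable (fun ω => ‖A.stochGrad η τ j k ω‖ ^ 2) P :=
    fun j hj => (memLp_two_iff_integrable_sq_norm (hg j hj).1.1).1 (hg j hj).1
  have hle : ∀ ω, ‖A.localWeight η τ i k ω - A.globalWeight η τ ω‖ ^ 2
      ≤ η τ ^ 2 * (i * ∑ j ∈ Finset.range i, ‖A.stochGrad η τ j k ω‖ ^ 2) := fun ω => by
    rw [localWeight_eq, sub_sub_cancel_left, norm_neg, norm_smul, mul_pow, Real.norm_eq_abs,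
      sq_abs]
    refine mul_le_mul_of_nonneg_left ?_ (sq_nonneg _)
    refine (pow_le_pow_left₀ (norm_nonneg _) (norm_sum_le _ _) 2).trans ?_
    simpa using sq_sum_le_card_mul_sum_sq (s := Finset.range i)
      (f := fun j => ‖A.stochGrad η τ j k ω‖)
  have hI : Integrable (fun ω => η τ ^ 2 *
      (i * ∑ j ∈ Finset.range i, ‖A.stochGrad η τ j k ω‖ ^ 2)) P :=
    ((integrable_finsetSum _ hint).const_mul _).const_mul _
  have hm : Measurable fun ω => ‖A.localWeight η τ i k ω - A.globalWeight η τ ω‖ ^ 2 :=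
    ((hA.measurable_localWeight hτ hi.le k).sub
      (hA.measurable_globalWeight hτ.le)).norm.pow_const 2
  have hD : Integrable (fun ω => ‖A.localWeight η τ i k ω - A.globalWeight η τ ω‖ ^ 2) P :=
    hI.mono' hm.aestronglyMeasurable (.of_forall fun ω => by
      rw [Real.norm_of_nonneg (sq_nonneg _)]; exact hle ω)
  refine ⟨hD, (integral_mono hD hI hle).trans ?_⟩
  rw [integral_const_mul, integral_const_mul, integral_finsetSum _ hint]
  calc η τ ^ 2 * (i * ∑ j ∈ Finset.range i, ∫ ω, ‖A.stochGrad η τ j k ω‖ ^ 2 ∂P)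
      ≤ η τ ^ 2 * (i * ∑ j ∈ Finset.range i, G ^ 2) := by
        gcongr with j hj
        exact (hg j hj).2
    _ = _ := by simp; ring

/-- F_k grows at most quadratically around z, so a finite second moment of the weight suffices. -/
theorem integrable_objective_globalWeight (hA : A.IsModel P T) {L μ : ℝ} (hμ : 0 < μ)
    {k : Fin N} (hsmooth : IsLSmooth L (A.F k)) (hconvex : StrongConvexOn Set.univ μ (A.F k))
    {τ : ℕ} (hτ : τ ≤ T) {z : Param d} (hx : MemLp (fun ω => A.globalWeight η τ ω - z) 2 P) :
    Integrable (fun ω => A.F k (A.globalWeight η τ ω)) P := by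
  have hsq := (memLp_two_iff_integrable_sq_norm hx.1).1 hx
  have h1 : Integrable (fun ω => A.F k (A.globalWeight η τ ω) - A.F k z) P := by
    refine ((((hx.integrable one_le_two).norm).const_mul _).add (hsq.const_mul L)).mono'
      ((hsmooth.1.continuous.measurable.comp
        (hA.measurable_globalWeight hτ)).sub_const _).aestronglyMeasurable
      (.of_forall fun ω => hconvex.abs_sub_le hμ hsmooth.1 hsmooth.2 _ z)
  exact (h1.add (integrable_const (A.F k z))).congr (.of_forall fun ω => by simp)

/-- The expected progress of a single local update. -/
theorem le_integral_inner_stepCoeff_smul (hA : A.IsModel P T) {L μ G C : ℝ} (hL : 0 < L)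
    (hμ : 0 < μ) (hmom : A.BoundedSecondMoment P T η G) {τ : ℕ} (hτ : τ < T) {i : ℕ}
    (hi : i < A.E) {k : Fin N} (hsmooth : IsLSmooth L (A.F k))
    (hconvex : StrongConvexOn Set.univ μ (A.F k)) (hC : ∀ᵐ ω ∂P, |A.p τ k ω| ≤ C)
    {z : Param d} (hx : MemLp (fun ω => A.globalWeight η τ ω - z) 2 P) :
    Integrable (fun ω => inner ℝ (A.globalWeight η τ ω - z)
        (A.stepCoeff τ i k ω • A.stochGrad η τ i k ω)) P ∧
      (∫ ω, A.stepCoeff τ i k ω ∂P) *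
        (∫ ω, A.F k (A.globalWeight η τ ω) ∂P - A.F k z
          + μ / 4 * ∫ ω, ‖A.globalWeight η τ ω - z‖ ^ 2 ∂P
          - (L + μ / 2) * (η τ ^ 2 * (i : ℝ) ^ 2 * G ^ 2))
        ≤ ∫ ω, inner ℝ (A.globalWeight η τ ω - z)
          (A.stepCoeff τ i k ω • A.stochGrad η τ i k ω) ∂P := by
  have hcg := (hA.memLp_stepCoeff_smul hmom hτ hi hC).1
  have hmx : Measurable fun ω => A.globalWeight η τ ω - z :=
    (hA.measurable_globalWeight hτ.le).sub_const z
  have hmc := hA.measurable_stepCoeff hτ i k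
  have hint : Integrable (fun ω => inner ℝ (A.globalWeight η τ ω - z)
      (A.stepCoeff τ i k ω • A.stochGrad η τ i k ω)) P :=
    (hx.norm.integrable_mul hcg.norm).mono' (hx.1.inner hcg.1)
      (.of_forall fun ω => norm_inner_le_norm _ _)
  refine ⟨hint, ?_⟩
  by_cases hpos : P (A.executed τ i k) = 0
  · have h0 := stepCoeff_ae_eq_zero hpos
    rw [integral_eq_zero_of_ae h0, zero_mul, integral_eq_zero_of_ae]
    filter_upwards [h0] with ω hω
    simp [hω]
  obtain ⟨hd1, hd2⟩ := hA.integral_drift_le hmom hτ hi hpos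
  have hF := hA.integrable_objective_globalWeight hμ hsmooth hconvex hτ.le hx
  have hsq := (memLp_two_iff_integrable_sq_norm hx.1).1 hx
  have hci := hA.integrable_stepCoeff hτ i hC
  have hc0 : ∀ᵐ ω ∂P, 0 ≤ A.stepCoeff τ i k ω := by
    filter_upwards [hA.p_nonneg τ hτ k] with ω hω
    exact mul_nonneg hω (by split_ifs <;> simp)
  -- The coefficient is moved to the first slot of the inner product: c(w - z) and the local weight
  -- precede the mini-batch, so averaging over the batch turns g into the full gradient.
  have hind : IndepFun
      (fun ω => (A.stepCoeff τ i k ω • (A.globalWeight η τ ω - z), A.localWeight η τ i k ω))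
      (A.ξ τ i k) P := by
    have hφ : Measurable fun x : ℝ × Param d × Param d => (x.1 • (x.2.1 - z), x.2.2) := by
      fun_prop
    exact (hA.indepFun_batch hτ hi k).comp hφ measurable_id
  have hswap : ∀ ω, inner ℝ (A.globalWeight η τ ω - z)
      (A.stepCoeff τ i k ω • A.stochGrad η τ i k ω)
      = inner ℝ (A.stepCoeff τ i k ω • (A.globalWeight η τ ω - z))
        (A.g k (A.localWeight η τ i k ω) (A.ξ τ i k ω)) := fun ω => by
    rw [inner_smul_left, inner_smul_right]
    rfl
  simp only [hswap] at hint ⊢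
  obtain ⟨hgi, hge⟩ := hind.integral_inner_of_mean (g := A.g k) (m := gradient (A.F k))
    (V := fun ω => A.stepCoeff τ i k ω • (A.globalWeight η τ ω - z)) (hmc.smul hmx) (hA.measurable_localWeight hτ hi.le k) (hA.measurable_ξ τ hτ i hi k)
    (hA.measurable_g k) (hA.unbiased τ hτ i hi k) hint
  rw [hge]
  -- The pointwise lower bound of `le_inner_gradient`. It depends only on the global and local
  -- weights, so it is independent of the coefficient and E[c h] = E[c] E[h].
  set h : Ω → ℝ := fun ω => A.F k (A.globalWeight η τ ω) - A.F k z
    + μ / 4 * ‖A.globalWeight η τ ω - z‖ ^ 2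
    - (L + μ / 2) * ‖A.localWeight η τ i k ω - A.globalWeight η τ ω‖ ^ 2 with hh
  have hFz : Integrable (fun ω => A.F k (A.globalWeight η τ ω) - A.F k z) P :=
    hF.sub (integrable_const _)
  have hFq : Integrable (fun ω => A.F k (A.globalWeight η τ ω) - A.F k z
      + μ / 4 * ‖A.globalWeight η τ ω - z‖ ^ 2) P := hFz.add (hsq.const_mul _)
  have hhi : Integrable h P := hFq.sub (hd1.const_mul _)
  have hindh : IndepFun (A.stepCoeff τ i k) h P := by
    have hFm : Measurable (A.F k) := hsmooth.1.continuous.measurable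
    have hφ : Measurable fun x : Param d × Param d × Param d => A.F k x.1 - A.F k z
        + μ / 4 * ‖x.1 - z‖ ^ 2 - (L + μ / 2) * ‖x.2.1 - x.1‖ ^ 2 := by
      fun_prop
    exact (hA.indepFun_stepCoeff_local hτ hi k).comp measurable_id hφ
  have hprod := hindh.integral_fun_mul_eq_mul_integral hci.1 hhi.1
  have hhe : ∫ ω, h ω ∂P = ∫ ω, A.F k (A.globalWeight η τ ω) ∂P - A.F k z
      + μ / 4 * ∫ ω, ‖A.globalWeight η τ ω - z‖ ^ 2 ∂P
      - (L + μ / 2) * ∫ ω, ‖A.localWeight η τ i k ω - A.globalWeight η τ ω‖ ^ 2 ∂P := by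
    simp only [hh]
    rw [integral_sub hFq (hd1.const_mul _),
      integral_add hFz (hsq.const_mul _), integral_sub hF (integrable_const _),
      integral_const_mul, integral_const_mul, integral_const]
    simp
  calc _ ≤ (∫ ω, A.stepCoeff τ i k ω ∂P) * ∫ ω, h ω ∂P := by
        refine mul_le_mul_of_nonneg_left ?_ (integral_nonneg_of_ae hc0)
        rw [hhe]
        gcongr
    _ = ∫ ω, A.stepCoeff τ i k ω * h ω ∂P := hprod.symm
    _ ≤ _ := by
        refine integral_mono_ae (hindh.integrable_mul hci hhi) hgi ?_
        filter_upwards [hc0] with ω hω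
        rw [inner_smul_left]
        exact mul_le_mul_of_nonneg_left
          (hconvex.le_inner_gradient hμ hsmooth.1 hsmooth.2 _ _ _) hω

/-- The recursion for the expected squared distance over one round. -/
theorem integral_globalWeight_succ_le (hA : A.IsModel P T) [Nonempty (Fin N)] {L μ G θ : ℝ}
    (hL : 0 < L) (hμ : 0 < μ) (hmom : A.BoundedSecondMoment P T η G)
    (hθ : ∀ τ < T, ∀ k, ∀ᵐ ω ∂P, A.p τ k ω / A.weight k ≤ θ)
    (hsmooth : ∀ k, IsLSmooth L (A.F k)) (hconvex : ∀ k, StrongConvexOn Set.univ μ (A.F k))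
    {τ : ℕ} (hτ : τ < T) (hη : 0 ≤ η τ)
    {z : Param d} (hx : MemLp (fun ω => A.globalWeight η τ ω - z) 2 P) :
    MemLp (fun ω => A.globalWeight η (τ + 1) ω - z) 2 P ∧
      ∫ ω, ‖A.globalWeight η (τ + 1) ω - z‖ ^ 2 ∂P
        ≤ ∫ ω, ‖A.globalWeight η τ ω - z‖ ^ 2 ∂P
          - 2 * η τ * ∑ k, A.meanUpdate P τ k *
            (∫ ω, A.F k (A.globalWeight η τ ω) ∂P - A.F k z
              + μ / 4 * ∫ ω, ‖A.globalWeight η τ ω - z‖ ^ 2 ∂P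
              - (L + μ / 2) * (η τ ^ 2 * (A.E * ((A.E : ℝ) - 1)) * G ^ 2))
          + η τ ^ 2 * (A.E * G ^ 2 *
            ∑ k, (∫ ω, A.p τ k ω ^ 2 * (A.s τ k ω : ℝ) ∂P) / A.weight k) := by
  have hC := fun k => hA.ae_abs_p_le hθ hτ k
  set u : Fin N → ℕ → Ω → Param d :=
    fun k i ω => A.stepCoeff τ i k ω • A.stochGrad η τ i k ω with hu
  have hu2 : ∀ k, ∀ i ∈ Finset.range A.E, MemLp (u k i) 2 P ∧
      ∫ ω, ‖u k i ω‖ ^ 2 ∂P ≤ (∫ ω, A.stepCoeff τ i k ω ^ 2 ∂P) * G ^ 2 := fun k i hi =>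
    hA.memLp_stepCoeff_smul hmom hτ (Finset.mem_range.1 hi) (hC k)
  have hin := fun k i (hi : i ∈ Finset.range A.E) =>
    hA.le_integral_inner_stepCoeff_smul hL hμ hmom hτ (Finset.mem_range.1 hi) (hsmooth k)
      (hconvex k) (hC k) hx
  have hw : ∀ ω, A.globalWeight η (τ + 1) ω - z = (A.globalWeight η τ ω - z)
      - η τ • ∑ k, ∑ i ∈ Finset.range A.E, u k i ω := fun ω => by
    rw [globalWeight_succ A η fun k => hA.s_le τ hτ k ω]
    simp only [hu]
    abel
  have hU : MemLp (fun ω => ∑ k, ∑ i ∈ Finset.range A.E, u k i ω) 2 P :=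
    memLp_finsetSum _ fun k _ => memLp_finsetSum _ fun i hi => (hu2 k i hi).1
  have hw2 : MemLp (fun ω => A.globalWeight η (τ + 1) ω - z) 2 P := by
    simp only [hw]
    exact hx.sub (hU.const_smul (η τ))
  refine ⟨hw2, ?_⟩
  have hsq := (memLp_two_iff_integrable_sq_norm hx.1).1 hx
  have husq : ∀ k, ∀ i ∈ Finset.range A.E, Integrable (fun ω => ‖u k i ω‖ ^ 2) P :=
    fun k i hi => (memLp_two_iff_integrable_sq_norm (hu2 k i hi).1.1).1 (hu2 k i hi).1
  have hwsq := (memLp_two_iff_integrable_sq_norm hw2.1).1 hw2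
  have hpt : ∀ ω, ‖A.globalWeight η (τ + 1) ω - z‖ ^ 2
      ≤ ‖A.globalWeight η τ ω - z‖ ^ 2
        - 2 * η τ * (∑ k, ∑ i ∈ Finset.range A.E, inner ℝ (A.globalWeight η τ ω - z) (u k i ω))
        + η τ ^ 2 * (A.E * ∑ k, (∑ i ∈ Finset.range A.E, ‖u k i ω‖ ^ 2) / A.weight k) :=
    fun ω => by
    have h1 := norm_sum_sum_sq_le Finset.univ A.E (fun k i => u k i ω)
      (fun k _ => hA.weight_pos k) hA.sum_weight
    rw [hw, norm_sub_sq_real, norm_smul, mul_pow, Real.norm_eq_abs, sq_abs, inner_smul_right]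
    simp only [inner_sum]
    have h2 := mul_le_mul_of_nonneg_left h1 (sq_nonneg (η τ))
    linarith
  have hI1 : Integrable (fun ω => ∑ k, ∑ i ∈ Finset.range A.E,
      inner ℝ (A.globalWeight η τ ω - z) (u k i ω)) P :=
    integrable_finsetSum _ fun k _ => integrable_finsetSum _ fun i hi => (hin k i hi).1
  have hI2 : ∀ k, Integrable (fun ω => (∑ i ∈ Finset.range A.E, ‖u k i ω‖ ^ 2) / A.weight k) P :=
    fun k => (integrable_finsetSum _ (husq k)).div_const _
  have hI3 : Integrable (fun ω => ∑ k, (∑ i ∈ Finset.range A.E, ‖u k i ω‖ ^ 2) / A.weight k) P :=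
    integrable_finsetSum _ fun k _ => hI2 k
  have hsub : Integrable (fun ω => ‖A.globalWeight η τ ω - z‖ ^ 2 - 2 * η τ *
      ∑ k, ∑ i ∈ Finset.range A.E, inner ℝ (A.globalWeight η τ ω - z) (u k i ω)) P :=
    hsq.sub (hI1.const_mul (2 * η τ))
  have hadd := (hI3.const_mul (A.E : ℝ)).const_mul (η τ ^ 2)
  refine (integral_mono hwsq (hsub.add hadd) hpt).trans ?_
  have hE : ∫ ω, (‖A.globalWeight η τ ω - z‖ ^ 2
        - 2 * η τ * (∑ k, ∑ i ∈ Finset.range A.E, inner ℝ (A.globalWeight η τ ω - z) (u k i ω))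
        + η τ ^ 2 * (A.E * ∑ k, (∑ i ∈ Finset.range A.E, ‖u k i ω‖ ^ 2) / A.weight k)) ∂P
      = ∫ ω, ‖A.globalWeight η τ ω - z‖ ^ 2 ∂P
        - 2 * η τ * (∑ k, ∑ i ∈ Finset.range A.E,
          ∫ ω, inner ℝ (A.globalWeight η τ ω - z) (u k i ω) ∂P)
        + η τ ^ 2 * (A.E * ∑ k, (∑ i ∈ Finset.range A.E, ∫ ω, ‖u k i ω‖ ^ 2 ∂P)
          / A.weight k) := by
    rw [integral_add hsub hadd, integral_sub hsq (hI1.const_mul _), integral_const_mul,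
      integral_const_mul, integral_const_mul,
      integral_finsetSum _ fun k _ => integrable_finsetSum _ fun i hi => (hin k i hi).1,
      integral_finsetSum _ fun k _ => hI2 k]
    congr 1
    · congr 2
      exact Finset.sum_congr rfl fun k _ =>
        integral_finsetSum _ fun i hi => (hin k i hi).1
    · congr 2
      refine Finset.sum_congr rfl fun k _ => ?_
      rw [integral_div, integral_finsetSum _ (husq k)]
  refine hE.trans_le ?_
  have hmean : ∀ k, ∑ i ∈ Finset.range A.E, ∫ ω, A.stepCoeff τ i k ω ∂P
      = A.meanUpdate P τ k := fun k => by
    rw [← integral_finsetSum _ fun i _ => hA.integrable_stepCoeff hτ i (hC k)]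
    exact integral_congr_ae (.of_forall fun ω => A.sum_stepCoeff (hA.s_le τ hτ k ω))
  have hmean2 : ∀ k, ∑ i ∈ Finset.range A.E, ∫ ω, A.stepCoeff τ i k ω ^ 2 ∂P
      = ∫ ω, A.p τ k ω ^ 2 * (A.s τ k ω : ℝ) ∂P := fun k => by
    rw [← integral_finsetSum _ fun i _ => hA.integrable_stepCoeff_sq hτ i (hC k)]
    exact integral_congr_ae (.of_forall fun ω => A.sum_stepCoeff_sq (hA.s_le τ hτ k ω))
  gcongr ?_ - 2 * η τ * ?_ + η τ ^ 2 * ?_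
  · refine Finset.sum_le_sum fun k _ => ?_
    rw [← hmean k, Finset.sum_mul]
    refine Finset.sum_le_sum fun i hi => le_trans ?_ (hin k i hi).2
    have hc0 : 0 ≤ ∫ ω, A.stepCoeff τ i k ω ∂P := by
      refine integral_nonneg_of_ae ?_
      filter_upwards [hA.p_nonneg τ hτ k] with ω hω
      exact mul_nonneg hω (by split_ifs <;> simp)
    have hiE : (i : ℝ) + 1 ≤ A.E := by exact_mod_cast Finset.mem_range.1 hi
    have hi0 : (0 : ℝ) ≤ i := Nat.cast_nonneg i
    -- Only i ≤ E - 1 occurs; this makes the drift vanish when E = 1.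
    have hi2 : (i : ℝ) ^ 2 ≤ A.E * ((A.E : ℝ) - 1) := by nlinarith
    gcongr
  · rw [mul_assoc]
    refine mul_le_mul_of_nonneg_left ?_ (Nat.cast_nonneg _)
    rw [Finset.mul_sum]
    refine Finset.sum_le_sum fun k _ => ?_
    rw [← hmean2 k, ← mul_div_assoc, Finset.mul_sum]
    refine div_le_div_of_nonneg_right (Finset.sum_le_sum fun i hi => ?_) (hA.weight_pos k).le
    rw [mul_comm]
    exact (hu2 k i hi).2

end IsModel

end

end FedAvg

/-! ### The scalar recursion. -/

/-- The step of the induction that yields a `1 / t` rate, with a bias in some of the steps. -/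
theorem decay_step {E β m t D V B M z g x y : ℝ} (hE : 0 < E) (ht : 4 * E ≤ t) (hβ : 0 < β)
    (hm : β * m = 16 * E) (hD : D = 4 * β * g) (hV : 0 ≤ V) (hB : β ^ 2 * (B / E) ≤ V)
    (hM : 0 ≤ M) (hz : 0 ≤ z) (hg : 0 ≤ g) (hx : 0 ≤ x) (hxt : x ≤ (M * D + V) / t)
    (hy : y ≤ (1 - β * (1 / t) * m / 2) * x + 2 * (β * (1 / t)) * (z * g)
      + (β * (1 / t)) ^ 2 * B) :
    y ≤ ((M + z) * D + V) / (t + E) := by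
  have ht0 : 0 < t := by linarith
  have hD0 : 0 ≤ D := by rw [hD]; positivity
  have h1 : β * (1 / t) * m / 2 = 8 * E / t := by
    rw [mul_right_comm, hm]; ring
  have h2 : (1 - 8 * E / t) * x ≤ (1 - 2 * E / t) * ((M * D + V) / t) := by
    have h3 : 0 ≤ 1 - 2 * E / t := by
      rw [sub_nonneg, div_le_one ht0]; linarith
    -- The factor 1 - 8E/t may be negative for t near 4E, so the bound on x cannot be inserted
    -- directly. The weaker contraction 1 - 2E/t is nonnegative and still enough: one E/t pays for
    -- passing from t to t + E, the other for the noise EV/t².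
    have h4 : 1 - 8 * E / t ≤ 1 - 2 * E / t := by gcongr; linarith
    exact (mul_le_mul_of_nonneg_right h4 hx).trans (mul_le_mul_of_nonneg_left hxt h3)
  have h5 : (β * (1 / t)) ^ 2 * B ≤ E * V / t ^ 2 := by
    have : (β * (1 / t)) ^ 2 * B = E * (β ^ 2 * (B / E)) / t ^ 2 := by field_simp
    rw [this]
    gcongr
  have h6 : 2 * (β * (1 / t)) * (z * g) = z * D / (2 * t) := by
    rw [hD]; field_simp; ring
  rw [h1, h6] at hy
  refine hy.trans ((add_le_add (add_le_add_left h2 _) h5).trans ?_)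
  -- The slack of the claim, written as a sum of two nonnegative fractions; the second one, from the
  -- new bias, needs t ≥ E.
  have h7 : ((M + z) * D + V) / (t + E)
      - ((1 - 2 * E / t) * ((M * D + V) / t) + z * D / (2 * t) + E * V / t ^ 2)
      = (M * D * (E * t + 2 * E ^ 2) + V * E ^ 2) / (t ^ 2 * (t + E))
        + z * D * (t - E) / (2 * t * (t + E)) := by
    field_simp
    ring
  have h8 : 0 ≤ (M * D * (E * t + 2 * E ^ 2) + V * E ^ 2) / (t ^ 2 * (t + E)) := by positivity
  have h9 : 0 ≤ z * D * (t - E) / (2 * t * (t + E)) :=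
    div_nonneg (mul_nonneg (mul_nonneg hz hD0) (by linarith)) (by positivity)
  linarith

/-! ### Participation means, the noise term and the bias. -/

namespace FedAvg

noncomputable section

namespace IsModel

variable {d N T : ℕ} {Ω : Type*} {Ξ : Fin N → Type*} [MeasurableSpace Ω]
  [∀ k, MeasurableSpace (Ξ k)] {P : Measure Ω} [IsProbabilityMeasure P] {A : FedAvg d N Ω Ξ}
  {θ : ℝ}

theorem integrable_p (hA : A.IsModel P T)
    (hθ : ∀ τ < T, ∀ k, ∀ᵐ ω ∂P, A.p τ k ω / A.weight k ≤ θ) {τ : ℕ} (hτ : τ < T) (k : Fin N) :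
    Integrable (A.p τ k) P :=
  .of_bound (hA.measurable_p τ hτ k).aestronglyMeasurable _ (hA.ae_abs_p_le hθ hτ k)

theorem measurable_natCast_s (hA : A.IsModel P T) {τ : ℕ} (hτ : τ < T) (k : Fin N) :
    Measurable fun ω => (A.s τ k ω : ℝ) :=
  measurable_from_nat.comp (hA.measurable_s τ hτ k)

theorem integrable_p_mul_s (hA : A.IsModel P T)
    (hθ : ∀ τ < T, ∀ k, ∀ᵐ ω ∂P, A.p τ k ω / A.weight k ≤ θ) {τ : ℕ} (hτ : τ < T) (k : Fin N) :
    Integrable (fun ω => A.p τ k ω * (A.s τ k ω : ℝ)) P :=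
  (hA.integrable_p hθ hτ k).mul_bdd (c := A.E) (hA.measurable_natCast_s hτ k).aestronglyMeasurable
    (.of_forall fun ω => by simpa using hA.s_le τ hτ k ω)

theorem integrable_p_sq_mul_s (hA : A.IsModel P T)
    (hθ : ∀ τ < T, ∀ k, ∀ᵐ ω ∂P, A.p τ k ω / A.weight k ≤ θ) {τ : ℕ} (hτ : τ < T) (k : Fin N) :
    Integrable (fun ω => A.p τ k ω ^ 2 * (A.s τ k ω : ℝ)) P :=
  ((hA.integrable_p_mul_s hθ hτ k).bdd_mul (hA.measurable_p τ hτ k).aestronglyMeasurable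
    (hA.ae_abs_p_le hθ hτ k)).congr (.of_forall fun ω => by ring)

theorem integrable_excess (hA : A.IsModel P T)
    (hθ : ∀ τ < T, ∀ k, ∀ᵐ ω ∂P, A.p τ k ω / A.weight k ≤ θ) {τ : ℕ} (hτ : τ < T) :
    Integrable (fun ω => max ((∑ k, A.p τ k ω) - 2) 0 *
      ∑ k, A.p τ k ω * (A.s τ k ω : ℝ)) P := by
  refine (integrable_finsetSum _ fun k _ => hA.integrable_p_mul_s hθ hτ k).bdd_mul
    (c := ∑ k, θ * A.weight k) ?_ ?_
  · exact (((Finset.measurable_fun_sum _ fun k _ => hA.measurable_p τ hτ k).sub_const 2).max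
      measurable_const).aestronglyMeasurable
  · filter_upwards [ae_all_iff.2 fun k => hA.ae_abs_p_le hθ hτ k] with ω hω
    have h1 : ∑ k, A.p τ k ω ≤ ∑ k, θ * A.weight k :=
      Finset.sum_le_sum fun k _ => (le_abs_self _).trans (hω k)
    have h2 : 0 ≤ ∑ k, θ * A.weight k :=
      Finset.sum_nonneg fun k _ => (abs_nonneg _).trans (hω k)
    rw [Real.norm_of_nonneg (le_max_right _ _)]
    exact max_le (by linarith) h2

theorem meanTotal_eq_sum (hA : A.IsModel P T)
    (hθ : ∀ τ < T, ∀ k, ∀ᵐ ω ∂P, A.p τ k ω / A.weight k ≤ θ) {τ : ℕ} (hτ : τ < T) :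
    A.meanTotal P τ = ∑ k, A.meanUpdate P τ k :=
  integral_finsetSum _ fun k _ => hA.integrable_p_mul_s hθ hτ k

theorem meanUpdate_nonneg (hA : A.IsModel P T) {τ : ℕ} (hτ : τ < T) (k : Fin N) :
    0 ≤ A.meanUpdate P τ k :=
  integral_nonneg_of_ae ((hA.p_nonneg τ hτ k).mono fun _ h => mul_nonneg h (Nat.cast_nonneg _))

/-- Follows from p ≤ θ p^k, s ≤ E and ∑ p^k = 1. It is what makes γ at least 4E, and forces E > 0
once S > 0. -/
theorem meanTotal_le (hA : A.IsModel P T) [Nonempty (Fin N)]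
    (hθ : ∀ τ < T, ∀ k, ∀ᵐ ω ∂P, A.p τ k ω / A.weight k ≤ θ) {τ : ℕ} (hτ : τ < T) :
    A.meanTotal P τ ≤ θ * A.E := by
  have h1 : ∀ k, A.meanUpdate P τ k ≤ θ * A.weight k * A.E := fun k => by
    have h2 : ∫ _, θ * A.weight k * (A.E : ℝ) ∂P = θ * A.weight k * A.E := by simp
    rw [← h2]
    refine integral_mono_ae (hA.integrable_p_mul_s hθ hτ k) (integrable_const _) ?_
    filter_upwards [hA.ae_abs_p_le hθ hτ k] with ω hω
    exact mul_le_mul ((le_abs_self _).trans hω) (by exact_mod_cast hA.s_le τ hτ k ω)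
      (Nat.cast_nonneg _) ((abs_nonneg _).trans hω)
  rw [hA.meanTotal_eq_sum hθ hτ]
  refine (Finset.sum_le_sum fun k _ => h1 k).trans_eq ?_
  rw [← Finset.sum_mul, ← Finset.mul_sum, hA.sum_weight, mul_one]

theorem meanTotal_pos (hA : A.IsModel P T)
    (hθ : ∀ τ < T, ∀ k, ∀ᵐ ω ∂P, A.p τ k ω / A.weight k ≤ θ) {τ : ℕ} (hτ : τ < T)
    (h : A.meanTotal P τ ≠ 0) : 0 < A.meanTotal P τ := by
  refine lt_of_le_of_ne ?_ h.symm
  rw [hA.meanTotal_eq_sum hθ hτ]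
  exact Finset.sum_nonneg fun k _ => hA.meanUpdate_nonneg hτ k

theorem _root_.FedAvg.noniid_nonneg {μ : ℝ} (hμ : 0 < μ) {k : Fin N}
    (hd : Differentiable ℝ (A.F k)) (hconvex : StrongConvexOn Set.univ μ (A.F k))
    (z : Param d) : 0 ≤ A.noniid z k :=
  sub_nonneg.2 (ciInf_le (hconvex.bddBelow_range hμ (hd z)) z)

/-- Those parts of the expectation of `B_τ` that come from the second moments of the stochastic
gradients. -/
theorem le_integral_BTerm (hA : A.IsModel P T) {L μ G : ℝ} {σ : Fin N → ℝ} (hL : 0 < L)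
    (hμ : 0 < μ) (hθ0 : 0 < θ)
    (hθ : ∀ τ < T, ∀ k, ∀ᵐ ω ∂P, A.p τ k ω / A.weight k ≤ θ) {z : Param d}
    (hnoniid : ∀ k, 0 ≤ A.noniid z k) (hE : 1 ≤ A.E) {τ : ℕ} (hτ : τ < T) :
    (2 + μ / (2 * (1 + θ) * L)) * A.E * ((A.E : ℝ) - 1) * G ^ 2 * A.meanTotal P τ
      + A.E * G ^ 2 * ∑ k, (∫ ω, A.p τ k ω ^ 2 * (A.s τ k ω : ℝ) ∂P) / A.weight k
      ≤ ∫ ω, A.BTerm L μ θ G σ z τ ω ∂P := by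
  have hps := fun k => hA.integrable_p_mul_s hθ hτ k
  have hpps := fun k => hA.integrable_p_sq_mul_s hθ hτ k
  have hps' : Integrable (fun ω => ∑ k, A.p τ k ω * (A.s τ k ω : ℝ)) P :=
    integrable_finsetSum _ fun k _ => hps k
  have hpw : ∀ k, Integrable (fun ω => A.p τ k ω ^ 2 / A.weight k * (A.s τ k ω : ℝ)) P :=
    fun k => ((hpps k).div_const (A.weight k)).congr (.of_forall fun ω => by ring)
  have hpw' : Integrable (fun ω => ∑ k, A.p τ k ω ^ 2 / A.weight k * (A.s τ k ω : ℝ)) P :=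
    integrable_finsetSum _ fun k _ => hpw k
  have hexc : Integrable (fun ω => θ * max ((∑ k, A.p τ k ω) - 2) 0 *
      ∑ k, A.p τ k ω * (A.s τ k ω : ℝ)) P :=
    ((hA.integrable_excess hθ hτ).const_mul θ).congr (.of_forall fun ω => by ring)
  have hB : Integrable (A.BTerm L μ θ G σ z τ) P :=
    ((((integrable_finsetSum _ fun k _ => (hps k).mul_const _).const_mul _).add
      ((hps'.add hexc).const_mul _)).add (hpw'.const_mul _)).add
      (integrable_finsetSum _ fun k _ => (hpps k).mul_const _)
  have hlow := (hps'.const_mul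
    ((2 + μ / (2 * (1 + θ) * L)) * A.E * ((A.E : ℝ) - 1) * G ^ 2)).add
    (hpw'.const_mul (A.E * G ^ 2))
  have hq : ∑ k, (∫ ω, A.p τ k ω ^ 2 * (A.s τ k ω : ℝ) ∂P) / A.weight k
      = ∫ ω, ∑ k, A.p τ k ω ^ 2 / A.weight k * (A.s τ k ω : ℝ) ∂P := by
    rw [integral_finsetSum _ fun k _ => hpw k]
    refine Finset.sum_congr rfl fun k _ => ?_
    rw [← integral_div]
    exact integral_congr_ae (.of_forall fun ω => by ring)
  rw [hq, meanTotal, ← integral_const_mul, ← integral_const_mul,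
    ← integral_add (hps'.const_mul _) (hpw'.const_mul _)]
  refine integral_mono_ae hlow hB ?_
  filter_upwards [ae_all_iff.2 fun k => hA.p_nonneg τ hτ k] with ω hω
  have hE1 : (0 : ℝ) ≤ (A.E : ℝ) - 1 := by
    rw [sub_nonneg]; exact_mod_cast hE
  have hs0 : ∀ k, 0 ≤ A.p τ k ω * (A.s τ k ω : ℝ) := fun k =>
    mul_nonneg (hω k) (Nat.cast_nonneg _)
  have e1 : 0 ≤ 2 * (2 + θ) * L * ∑ k, A.p τ k ω * (A.s τ k ω : ℝ) * A.noniid z k :=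
    mul_nonneg (by positivity) (Finset.sum_nonneg fun k _ => mul_nonneg (hs0 k) (hnoniid k))
  have e2 : 0 ≤ (2 + μ / (2 * (1 + θ) * L)) * A.E * ((A.E : ℝ) - 1) * G ^ 2 *
      (θ * max ((∑ k, A.p τ k ω) - 2) 0 * ∑ k, A.p τ k ω * (A.s τ k ω : ℝ)) :=
    mul_nonneg (by positivity) (mul_nonneg (mul_nonneg hθ0.le (le_max_right _ _))
      (Finset.sum_nonneg fun k _ => hs0 k))
  -- B contains this sum with the factor 2EG², the recursion uses EG²; the surplus copy is dropped,
  -- as are the terms in `e1`, `e2` and `e4`.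
  have e3 : 0 ≤ A.E * G ^ 2 * ∑ k, A.p τ k ω ^ 2 / A.weight k * (A.s τ k ω : ℝ) :=
    mul_nonneg (by positivity) (Finset.sum_nonneg fun k _ =>
      mul_nonneg (div_nonneg (sq_nonneg _) (hA.weight_pos k).le) (Nat.cast_nonneg _))
  have e4 : 0 ≤ ∑ k, A.p τ k ω ^ 2 * (A.s τ k ω : ℝ) * σ k ^ 2 :=
    Finset.sum_nonneg fun k _ => by positivity
  simp only [BTerm]
  linarith

/-- The aggregated suboptimality is bounded below by the heterogeneity of the devices, and it is
nonnegative if the mean updates are proportional to the weights. -/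
theorem neg_bias_le (hA : A.IsModel P T) {μ : ℝ} (hμ : 0 < μ)
    (hd : ∀ k, Differentiable ℝ (A.F k)) (hconvex : ∀ k, StrongConvexOn Set.univ μ (A.F k))
    [Nonempty (Fin N)] {z : Param d} (hz : ∀ w, A.objective z ≤ A.objective w) {W : Ω → Param d}
    (hF : ∀ k, Integrable (fun ω => A.F k (W ω)) P) {τ : ℕ} (hτ : τ < T) :
    -(A.biasIndicator P τ * ∑ k, A.meanUpdate P τ k * A.noniid z k)
      ≤ ∑ k, A.meanUpdate P τ k * (∫ ω, A.F k (W ω) ∂P - A.F k z) := by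
  unfold biasIndicator
  split_ifs with hc
  · obtain ⟨c, hc⟩ := hc
    have hm : ∀ k, A.meanUpdate P τ k = c * A.weight k := fun k =>
      (div_eq_iff (hA.weight_pos k).ne').1 (hc k)
    obtain ⟨k₀⟩ := ‹Nonempty (Fin N)›
    have hc0 : 0 ≤ c := by
      rw [← hc k₀]
      exact div_nonneg (hA.meanUpdate_nonneg hτ k₀) (hA.weight_pos k₀).le
    -- Proportional means reassemble the local objectives into c times the global one, which z
    -- minimizes.
    have h1 : ∑ k, A.meanUpdate P τ k * (∫ ω, A.F k (W ω) ∂P - A.F k z)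
        = c * (∫ ω, A.objective (W ω) ∂P - A.objective z) := by
      simp only [objective]
      rw [integral_finsetSum _ fun k _ => (hF k).const_mul _, ← Finset.sum_sub_distrib,
        Finset.mul_sum]
      refine Finset.sum_congr rfl fun k _ => ?_
      rw [integral_const_mul, hm]
      ring
    have h2 : A.objective z ≤ ∫ ω, A.objective (W ω) ∂P := by
      have h3 : ∫ _, A.objective z ∂P = A.objective z := by simp
      rw [← h3]
      exact integral_mono (integrable_const _)
        (integrable_finsetSum _ fun k _ => (hF k).const_mul _) fun ω => hz (W ω)
    rw [h1]
    simpa using mul_nonneg hc0 (sub_nonneg.2 h2)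
  · rw [Nat.cast_one, one_mul, ← Finset.sum_neg_distrib]
    refine Finset.sum_le_sum fun k _ => ?_
    rw [← mul_neg]
    refine mul_le_mul_of_nonneg_left ?_ (hA.meanUpdate_nonneg hτ k)
    -- Without proportionality, each device can only be compared with its own infimum, at the price
    -- Γ_k.
    have h1 : ⨅ w, A.F k w ≤ ∫ ω, A.F k (W ω) ∂P := by
      have h2 : ∫ _, (⨅ w, A.F k w) ∂P = ⨅ w, A.F k w := by simp
      rw [← h2]
      exact integral_mono (integrable_const _) (hF k) fun ω =>
        ciInf_le ((hconvex k).bddBelow_range hμ (hd k z)) (W ω)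
    unfold noniid
    linarith

end IsModel

end

end FedAvg

/-! ### The constants and the induction over rounds. -/

theorem theorem3p1 {d N T : ℕ} (hT : 0 < T)
    {Ω : Type*} [MeasurableSpace Ω] (P : Measure Ω) [IsProbabilityMeasure P]
    {Ξ : Fin N → Type*} [∀ k, MeasurableSpace (Ξ k)]
    (A : FedAvg d N Ω Ξ) (hA : A.IsModel P T)
    (L μ θ G : ℝ) (σ : Fin N → ℝ) (hL : 0 < L) (hμ : 0 < μ) (hθ : 0 < θ)
    (wStar : Param d) (hwStar : ∀ w, A.objective wStar ≤ A.objective w)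
    (hsmooth : ∀ k, IsLSmooth L (A.F k))
    (hconvex : ∀ k, StrongConvexOn Set.univ μ (A.F k))
    (hvariance : A.BoundedVariance P T (A.stepSize P L μ θ) σ)
    (hmoment : A.BoundedSecondMoment P T (A.stepSize P L μ θ) G)
    (hcoeff : ∀ τ < T, ∀ k, ∀ᵐ ω ∂P, A.p τ k ω / A.weight k ≤ θ)
    (hinvariant : A.TimeInvariant P T)
    (hnonzero : ∀ τ < T, A.meanTotal P τ ≠ 0) :
    ∀ τ ≤ T,
      Integrable (fun ω => ‖A.globalWeight (A.stepSize P L μ θ) τ ω - wStar‖ ^ 2) P ∧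
      ∫ ω, ‖A.globalWeight (A.stepSize P L μ θ) τ ω - wStar‖ ^ 2 ∂P ≤
        (A.biasedRounds P τ * A.DConst P μ wStar + A.VConst P L μ θ G σ wStar) /
          (τ * A.E + A.gammaConst P L μ θ) := by
  have : Nonempty (Fin N) := by
    by_contra h
    rw [not_nonempty_iff] at h
    exact hnonzero 0 hT (by simp [FedAvg.meanTotal])
  have hS := hA.meanTotal_pos hcoeff hT (hnonzero 0 hT)
  have hSle := hA.meanTotal_le hcoeff hT
  have hStot : ∀ τ < T, A.meanTotal P τ = A.meanTotal P 0 := fun τ hτ => by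
    rw [hA.meanTotal_eq_sum hcoeff hτ, hA.meanTotal_eq_sum hcoeff hT]
    exact Finset.sum_congr rfl fun k _ => hinvariant.mean_ps τ hτ k
  have hE0 : (0 : ℝ) < A.E := by
    by_contra h
    nlinarith
  have hE1 : 1 ≤ A.E := by exact_mod_cast hE0
  have hE1' : (1 : ℝ) ≤ A.E := by exact_mod_cast hE1
  have hnoniid : ∀ k, 0 ≤ A.noniid wStar k := fun k =>
    FedAvg.noniid_nonneg hμ (hsmooth k).1 (hconvex k) wStar
  set η := A.stepSize P L μ θ with hη
  set S := A.meanTotal P 0 with hS_def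
  set γ := A.gammaConst P L μ θ with hγ
  set V := A.VConst P L μ θ G σ wStar with hV
  set β : ℝ := 16 * A.E / (μ * S) with hβ
  set Γ : ℝ := ∑ k, A.meanUpdate P 0 k * A.noniid wStar k with hΓ
  have hβ0 : 0 < β := by positivity
  have hβm : β * (μ * S) = 16 * A.E := div_mul_cancel₀ _ (by positivity)
  have hΓ0 : 0 ≤ Γ := Finset.sum_nonneg fun k _ =>
    mul_nonneg (hA.meanUpdate_nonneg hT k) (hnoniid k)
  have hD : A.DConst P μ wStar = 4 * β * Γ := by
    simp only [FedAvg.DConst, hβ, hΓ, hS_def]; ring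
  -- The second entry of γ works because S ≤ θE. It gives t ≥ 4E for `decay_step`, and γ ≥ 1, hence
  -- γ ≤ γ² in the base case.
  have hγE : 4 * (A.E : ℝ) ≤ γ := by
    refine le_trans ?_ (le_max_right _ _)
    rw [le_div_iff₀ hS]
    nlinarith
  have hγ1 : 1 ≤ γ := by linarith
  -- The first entry of γ is exactly this product; it encodes the step-size condition η ≤
  -- 1/(2(1+θ)L).
  have hγβ : β * (2 * (1 + θ) * L) ≤ γ := by
    refine le_trans (le_of_eq ?_) (le_max_left _ _)
    simp only [hβ, hS_def]; ring
  have hV1 : γ ^ 2 * ∫ ω, ‖A.w₀ ω - wStar‖ ^ 2 ∂P ≤ V := le_max_left _ _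
  have hV2 : β ^ 2 * ((∫ ω, A.BTerm L μ θ G σ wStar 0 ω ∂P) / A.E) ≤ V := le_max_right _ _
  have hd0 : 0 ≤ ∫ ω, ‖A.w₀ ω - wStar‖ ^ 2 ∂P := integral_nonneg fun ω => sq_nonneg _
  have hV0 : 0 ≤ V := le_trans (by positivity) hV1
  have hB := hA.le_integral_BTerm (G := G) (σ := σ) hL hμ hθ hcoeff hnoniid hE1 hT
  suffices h : ∀ τ ≤ T, MemLp (fun ω => A.globalWeight η τ ω - wStar) 2 P ∧
      ∫ ω, ‖A.globalWeight η τ ω - wStar‖ ^ 2 ∂P ≤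
        (A.biasedRounds P τ * A.DConst P μ wStar + V) / (τ * A.E + γ) from fun τ hτ =>
    ⟨(memLp_two_iff_integrable_sq_norm (h τ hτ).1.1).1 (h τ hτ).1, (h τ hτ).2⟩
  intro τ
  induction τ with
  | zero =>
    refine fun _ => ⟨hA.memLp_w₀.sub (memLp_const wStar), ?_⟩
    simp only [FedAvg.biasedRounds, Finset.range_zero, Finset.sum_empty, Nat.cast_zero, zero_mul,
      zero_add]
    rw [le_div_iff₀ (by linarith)]
    refine le_trans ?_ hV1
    rw [mul_comm]
    exact mul_le_mul_of_nonneg_right (by nlinarith) hd0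
  | succ τ ih =>
    intro hτ
    replace hτ : τ < T := hτ
    obtain ⟨hx, hΔ⟩ := ih hτ.le
    set t : ℝ := τ * A.E + γ with ht
    have htγ : γ ≤ t := le_add_of_nonneg_left (by positivity)
    have ht0 : 0 < t := by linarith
    have hητ : η τ = β * (1 / t) := by
      simp only [hη, FedAvg.stepSize, hStot τ hτ, hβ, ht]
      rfl
    have hη0 : 0 ≤ η τ := by rw [hητ]; positivity
    have hηL : η τ * (2 * (1 + θ) * L) ≤ 1 := by
      rw [hητ, mul_one_div, div_mul_eq_mul_div, div_le_one ht0]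
      exact hγβ.trans htγ
    obtain ⟨hx', hrec⟩ := hA.integral_globalWeight_succ_le hL hμ hmoment hcoeff hsmooth hconvex
      hτ hη0 hx
    refine ⟨hx', ?_⟩
    have hbias := hA.neg_bias_le hμ (fun k => (hsmooth k).1) hconvex hwStar
      (fun k => hA.integrable_objective_globalWeight hμ (hsmooth k) (hconvex k) hτ.le hx) hτ
    have hmean : ∀ k, A.meanUpdate P τ k = A.meanUpdate P 0 k := hinvariant.mean_ps τ hτ
    simp only [hmean] at hbias hrec
    simp only [hinvariant.mean_ppS τ hτ] at hrec
    rw [← hΓ] at hbias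
    set Δ := ∫ ω, ‖A.globalWeight η τ ω - wStar‖ ^ 2 ∂P with hΔ_def
    set K : ℝ := (A.E : ℝ) * ((A.E : ℝ) - 1) * G ^ 2 with hK
    have hK0 : 0 ≤ K := mul_nonneg (mul_nonneg hE0.le (by linarith)) (sq_nonneg G)
    have hsplit : ∑ k, A.meanUpdate P 0 k *
        (∫ ω, A.F k (A.globalWeight η τ ω) ∂P - A.F k wStar + μ / 4 * Δ
          - (L + μ / 2) * (η τ ^ 2 * (A.E * ((A.E : ℝ) - 1)) * G ^ 2))
        = ∑ k, A.meanUpdate P 0 k * (∫ ω, A.F k (A.globalWeight η τ ω) ∂P - A.F k wStar)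
          + S * (μ / 4 * Δ - (L + μ / 2) * (η τ ^ 2 * K)) := by
      rw [hS_def, hA.meanTotal_eq_sum hcoeff hT, Finset.sum_mul, ← Finset.sum_add_distrib]
      refine Finset.sum_congr rfl fun k _ => ?_
      rw [hK]
      ring
    rw [hsplit] at hrec
    -- The drift enters the recursion as 2η(L + μ/2)·η²KS. One factor η is absorbed by the step-size
    -- condition, leaving an η² term with the coefficient found in B.
    have hcoef : η τ * (2 * L + μ) ≤ 2 + μ / (2 * (1 + θ) * L) := by
      have h1 : η τ * μ ≤ μ / (2 * (1 + θ) * L) := by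
        rw [le_div_iff₀ (by positivity)]
        linarith [mul_le_mul_of_nonneg_left hηL hμ.le]
      have h2 : 0 ≤ η τ * (θ * L) := mul_nonneg hη0 (mul_pos hθ hL).le
      linarith
    have hnoise : η τ * (2 * L + μ) * (K * S)
        ≤ (2 + μ / (2 * (1 + θ) * L)) * A.E * ((A.E : ℝ) - 1) * G ^ 2 * S := by
      refine (mul_le_mul_of_nonneg_right hcoef (mul_nonneg hK0 hS.le)).trans_eq ?_
      rw [hK]
      ring
    have hΔ0 : 0 ≤ Δ := integral_nonneg fun ω => sq_nonneg _
    have hM : (A.biasedRounds P (τ + 1) : ℝ) = A.biasedRounds P τ + A.biasIndicator P τ := by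
      simp [FedAvg.biasedRounds, Finset.sum_range_succ]
    have htE : ((τ + 1 : ℕ) : ℝ) * A.E + γ = t + A.E := by
      rw [ht]; push_cast; ring
    rw [hM, htE]
    -- Here m = μS, z is the bias indicator of the round and B is the mean of `BTerm` at round 0,
    -- which represents all rounds by time invariance.
    refine decay_step hE0 (hγE.trans htγ) hβ0 hβm hD hV0 hV2 (Nat.cast_nonneg _)
      (Nat.cast_nonneg _) hΓ0 hΔ0 hΔ (hrec.trans ?_)
    rw [← hητ]
    have h1 := mul_le_mul_of_nonneg_left hbias hη0
    have h2 := mul_le_mul_of_nonneg_left hnoise (sq_nonneg (η τ))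
    have h3 := mul_le_mul_of_nonneg_left hB (sq_nonneg (η τ))
    linarith
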